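/- **Theorem 3.1.** *Setting.* Consider $\dot x=f(x,u)+g(x,u)\theta$ with $x\in\mathbb R^n$, $u\in\mathbb R^m$, $\theta\in\mathbb R^l$ constant, where $f:\mathbb R^n\times\mathbb R^m\to\mathbb R^n$ and $g:\mathbb R^n\times\mathbb R^m\to\mathbb R^{n\times l}$ are smooth with $f(0,0)=0$, $g(0,0)=0$. Let $k:\mathbb R^l\times\mathbb R^n\to\mathbb R^m$ be smooth with $k(\theta,0)=0$ for all $\theta$, and let $V_\theta,Q_\theta:\mathbb R^n\to\mathbb R_+$ ($\theta\in\mathbb R^l$) be positive definite and radially unbounded (all sublevel sets compact), with $(\theta,x)\mapsto V_\theta(x)$ and $(\theta,x)\mapsto Q_\theta(x)$ continuous. $|\cdot|$ is the Euclidean norm. Assume: (H1) For each $\theta$, the origin is globally asymptotically stable for $\dot x=f(x,k(\theta,x))+g(x,k(\theta,x))\theta$, and every solution satisfies $V_\theta(x(t))\le Q_\theta(x(0))$ for all $t\ge 0$. (H2) For every non-empty compact $\Theta\subset\mathbb R^l$ and every $M\ge0$ there is $R>0$ such that $\theta\in\Theta$, $V_\theta(x)\le M$ imply $|x|\le R$.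 (H3) $N$ is a positive integer with the following property: if $0=\tau_0<\tau_1<\dots<\tau_N$, $\theta,d_0,\dots,d_N\in\mathbb R^l$ with $d_i\ne0$ for $i=0,\dots,N$, and $x:[0,\tau_N]\to\mathbb R^n$ is continuous, right differentiable, $C^1$ on $[0,\tau_N]\setminus\{\tau_0,\dots,\tau_N\}$, with $\dot x(t)=f(x(t),k(\theta+d_i,x(t)))+g(x(t),k(\theta+d_i,x(t)))\theta$ for $t\in[\tau_i,\tau_{i+1})$, $i=0,\dots,N-1$ (right derivative at $\tau_i$), and $g(x(t),k(\theta+d_j,x(t)))d_{i+1}=0$ for $t\in[\tau_j,\tau_{j+1}]$, $0\le j\le i\le N-1$, then $x(t)=0$ for all $t\in[0,\tau_N]$. *Closed loop.* Fix $T>0$, a continuous positive definite $a:\mathbb R^n\to\mathbb R_+$ and an integer $\tilde N>N$. The hybrid closed loop, with event times $0=\tau_0<\tau_1<\cdots$, is given by the plant together with - $u(t)=k(\hat\theta(\tau_i),x(t))$ and $\hat\theta(t)=\hat\theta(\tau_i)$ for $t\in[\tau_i,\tau_{i+1})$; - $\tau_{i+1}=\min(\tau_i+T,r_i)$, where $r_i=\inf\{t>\tau_i: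 V_{\hat\theta(\tau_i)}(x(t))=Q_{\hat\theta(\tau_i)}(x(\tau_i))+a(x(\tau_i))\}$ (with $\inf\emptyset=+\infty$) if $x(\tau_i)\ne0$, and $r_i=\tau_i+T$ if $x(\tau_i)=0$; - $\hat\theta(\tau_{i+1})$ is the minimizer of $|\gamma-\hat\theta(\tau_i)|^2$ over all $\gamma\in\mathbb R^l$ with $Z_{i+1}=G_{i+1}\gamma$, where $\mu_{i+1}=\min\{\tau_j: 0\le j\le i,\ \tau_j\ge\tau_{i+1}-\tilde NT\}$, $$G_{i+1}=\int_{\mu_{i+1}}^{\tau_{i+1}}\!\!\int_{\mu_{i+1}}^{\tau_{i+1}}q(t,\sigma)^{\top}q(t,\sigma)\,d\sigma\,dt,\qquad Z_{i+1}=\int_{\mu_{i+1}}^{\tau_{i+1}}\!\!\int_{\mu_{i+1}}^{\tau_{i+1}}q(t,\sigma)^{\top}p(t,\sigma)\,d\sigma\,dt,$$ $p(t,\sigma)=x(t)-x(\sigma)-\int_\sigma^tf(x(s),u(s))\,ds$ and $q(t,\sigma)=\int_\sigma^tg(x(s),u(s))\,ds$. A solution on $[0,s)$, $0<s\le+\infty$,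 is a triple $(x,\hat\theta,(\tau_i))$ with $x$ continuous that obeys these rules on $[0,s)$, the intervals $[\tau_i,\tau_{i+1})$ covering $[0,s)$. *Claim.* There are functions $\tilde\sigma_{\theta,\hat\theta}\in KL$, indexed by $\theta,\hat\theta\in\mathbb R^l$ (that is, $\tilde\sigma_{\theta,\hat\theta}:\mathbb R_+\times\mathbb R_+\to\mathbb R_+$ is continuous, for each $t\ge 0$ strictly increasing in its first argument and zero when that argument is zero, and for each fixed first argument nonincreasing in $t$ with limit $0$ as $t\to+\infty$), such that for every $\theta,\hat\theta_0\in\mathbb R^l$ and $x_0\in\mathbb R^n$ the hybrid closed loop with $x(0)=x_0$, $\hat\theta(0)=\hat\theta_0$ has a solution defined for all $t\ge0$; it is unique (every solution on an interval $[0,s)$ is a restriction of it); and it satisfies $|x(t)|\le\tilde\sigma_{\theta,\hat\theta_0}(|x_0|,t)$ for all $t\ge0$. Moreover, if $x_0\ne0$, then $\hat\theta(t)=\theta$ for all $t\ge NT$. -/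

import Mathlib

open Set Filter Topology
open scoped ContDiff

noncomputable section

namespace RegAdaptive

/-- The Euclidean space of column vectors of length `n`, with the Euclidean norm. -/
abbrev Vec (n : ℕ) := EuclideanSpace ℝ (Fin n)

/-- A function on `Vec n` is positive definite if it vanishes at the origin and is positive
elsewhere. -/
def IsPosDef {n : ℕ} (V : Vec n → ℝ) : Prop :=
  V 0 = 0 ∧ ∀ x, x ≠ 0 → 0 < V x

/-- Radial unboundedness: all sublevel sets are compact. -/
def IsRadiallyUnbounded {n : ℕ} (V : Vec n → ℝ) : Prop :=
  ∀ M : ℝ, 0 < M → IsCompact {x | V x ≤ M}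

/-- Class `K` functions on the nonnegative reals (values at negative arguments play no role;
nonnegativity of the values follows). -/
structure IsClassK (α : ℝ → ℝ) : Prop where
  continuousOn : ContinuousOn α (Ici 0)
  strictMonoOn : StrictMonoOn α (Ici 0)
  map_zero : α 0 = 0

/-- Class `KL` functions of `(s, t)` with `s, t ≥ 0`: jointly continuous, of class `K` in `s`,
and nonincreasing in `t` with limit zero. -/
structure IsClassKL (σ : ℝ → ℝ → ℝ) : Prop where
  continuousOn : ContinuousOn (fun p : ℝ × ℝ => σ p.1 p.2) (Ici 0 ×ˢ Ici 0)
  classK : ∀ t, 0 ≤ t → IsClassK (fun s => σ s t)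
  antitoneOn : ∀ s, 0 ≤ s → AntitoneOn (σ s) (Ici 0)
  tendsto_zero : ∀ s, 0 ≤ s → Tendsto (σ s) atTop (𝓝 0)

/-- `x` solves the autonomous equation `x' = F x` on `[0, ∞)` (one-sided derivative at `0`). -/
def IsForwardSolution {n : ℕ} (F : Vec n → Vec n) (x : ℝ → Vec n) : Prop :=
  ∀ t, 0 ≤ t → HasDerivWithinAt x (F (x t)) (Ici 0) t

/-- Global asymptotic stability of the origin for `x' = F x`: the origin is an equilibrium,
every initial state has a solution on `[0, ∞)`, the origin is Lyapunov stable, and all solutions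
converge to it.  (It is used for smooth `F`, for which solutions are unique.) -/
structure IsGAS {n : ℕ} (F : Vec n → Vec n) : Prop where
  equilibrium : F 0 = 0
  complete : ∀ x₀, ∃ x, IsForwardSolution F x ∧ x 0 = x₀
  stable : ∀ ε : ℝ, 0 < ε → ∃ δ : ℝ, 0 < δ ∧ ∀ x, IsForwardSolution F x →
    ‖x 0‖ < δ → ∀ t, 0 ≤ t → ‖x t‖ < ε
  attractive : ∀ x, IsForwardSolution F x → Tendsto x atTop (𝓝 0)

/-- The data of the system `x' = f(x, u) + g(x, u) θ`.  The `n × l` matrix `g(x, u)` is regarded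
as the linear map from `Vec l` to `Vec n` which it represents. -/
structure Plant (n m l : ℕ) where
  f : Vec n × Vec m → Vec n
  g : Vec n × Vec m → (Vec l →L[ℝ] Vec n)
  f_smooth : ContDiff ℝ ∞ f
  g_smooth : ContDiff ℝ ∞ g
  f_zero : f (0, 0) = 0
  g_zero : g (0, 0) = 0

/-- The nominal feedback `k(θ, x)` and the two families of Lyapunov-like functions
`V_θ(x)`, `Q_θ(x)`. -/
structure NominalDesign (n m l : ℕ) where
  k : Vec l → Vec n → Vec m
  V : Vec l → Vec n → ℝ
  Q : Vec l → Vec n → ℝ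
  k_smooth : ContDiff ℝ ∞ (fun p : Vec l × Vec n => k p.1 p.2)
  k_zero : ∀ θ, k θ 0 = 0
  V_continuous : Continuous (fun p : Vec l × Vec n => V p.1 p.2)
  Q_continuous : Continuous (fun p : Vec l × Vec n => Q p.1 p.2)
  V_posDef : ∀ θ, IsPosDef (V θ)
  Q_posDef : ∀ θ, IsPosDef (Q θ)
  V_radial : ∀ θ, IsRadiallyUnbounded (V θ)
  Q_radial : ∀ θ, IsRadiallyUnbounded (Q θ)

variable {n m l : ℕ}

/-- The right-hand side `f(x, k(ϑ, x)) + g(x, k(ϑ, x)) θ`: true parameter `θ`, feedback computed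
with the parameter value `ϑ`. -/
def loopField (P : Plant n m l) (D : NominalDesign n m l) (θ ϑ : Vec l) (x : Vec n) : Vec n :=
  P.f (x, D.k ϑ x) + P.g (x, D.k ϑ x) θ

/-- Stabilizability: with the true parameter in the feedback, the origin is globally
asymptotically stable, and `V_θ(x(t)) ≤ Q_θ(x(0))` along solutions. -/
def Stabilizability (P : Plant n m l) (D : NominalDesign n m l) : Prop :=
  ∀ θ : Vec l, IsGAS (loopField P D θ θ) ∧
    ∀ x : ℝ → Vec n, IsForwardSolution (loopField P D θ θ) x →
      ∀ t, 0 ≤ t → D.V θ (x t) ≤ D.Q θ (x 0)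

/-- Coercivity of the family `V_θ`, uniform for `θ` in compact sets. -/
def UniformCoercivity (D : NominalDesign n m l) : Prop :=
  ∀ Θ : Set (Vec l), Θ.Nonempty → IsCompact Θ → ∀ M : ℝ, 0 ≤ M → ∃ R : ℝ, 0 < R ∧
    ∀ θ ∈ Θ, ∀ x : Vec n, D.V θ x ≤ M → ‖x‖ ≤ R

/-- Parameter observability with index `N`.  Only `τ 0, …, τ N` and `d 0, …, d N` matter.
The derivative is taken within `[τ i, τ (i+1))`: it is the right derivative at `τ i` and the
ordinary derivative in the interior.  Right differentiability of `x` and continuity of its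
derivative away from the times `τ i` follow from the equation and the continuity of `x`. -/
def ParameterObservability (P : Plant n m l) (D : NominalDesign n m l) (N : ℕ) : Prop :=
  ∀ (τ : ℕ → ℝ) (θ : Vec l) (d : ℕ → Vec l) (x : ℝ → Vec n),
    τ 0 = 0 → (∀ i, i < N → τ i < τ (i + 1)) →
    (∀ i, i ≤ N → d i ≠ 0) →
    ContinuousOn x (Icc 0 (τ N)) →
    (∀ i, i < N → ∀ t ∈ Ico (τ i) (τ (i + 1)),
      HasDerivWithinAt x (loopField P D θ (θ + d i) (x t)) (Ico (τ i) (τ (i + 1))) t) →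
    (∀ i, i < N → ∀ j, j ≤ i → ∀ t ∈ Icc (τ j) (τ (j + 1)),
      P.g (x t, D.k (θ + d j) (x t)) (d (i + 1)) = 0) →
    ∀ t ∈ Icc 0 (τ N), x t = 0

/-- The control input generated by the state `x` and the (piecewise constant) estimate `ϑ`. -/
def input (D : NominalDesign n m l) (x : ℝ → Vec n) (ϑ : ℝ → Vec l) (t : ℝ) : Vec m :=
  D.k (ϑ t) (x t)

/-- `p(t, σ) = x(t) - x(σ) - ∫_σ^t f(x(s), u(s)) ds`. -/
def pSignal (P : Plant n m l) (x : ℝ → Vec n) (u : ℝ → Vec m) (t σ : ℝ) : Vec n :=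
  x t - x σ - ∫ s in σ..t, P.f (x s, u s)

/-- `q(t, σ) = ∫_σ^t g(x(s), u(s)) ds`. -/
def qSignal (P : Plant n m l) (x : ℝ → Vec n) (u : ℝ → Vec m) (t σ : ℝ) :
    Vec l →L[ℝ] Vec n :=
  ∫ s in σ..t, P.g (x s, u s)

/-- `G(τ, μ) = ∫_μ^τ ∫_μ^τ q(t, σ)ᵀ q(t, σ) dσ dt`. -/
def gramG (P : Plant n m l) (x : ℝ → Vec n) (u : ℝ → Vec m) (τ μ : ℝ) : Vec l →L[ℝ] Vec l :=
  ∫ t in μ..τ, ∫ σ in μ..τ,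
    (ContinuousLinearMap.adjoint (qSignal P x u t σ)).comp (qSignal P x u t σ)

/-- `Z(τ, μ) = ∫_μ^τ ∫_μ^τ q(t, σ)ᵀ p(t, σ) dσ dt`. -/
def dataZ (P : Plant n m l) (x : ℝ → Vec n) (u : ℝ → Vec m) (τ μ : ℝ) : Vec l :=
  ∫ t in μ..τ, ∫ σ in μ..τ,
    ContinuousLinearMap.adjoint (qSignal P x u t σ) (pSignal P x u t σ)

/-- The time `r` of the event trigger started at the event time `τ`, for a trajectory `(x, ϑ)`
which is defined on `[0, s)`: the first `t > τ` at which `V_{ϑ(τ)}(x(t))` reaches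
`Q_{ϑ(τ)}(x(τ)) + a(x(τ))` (and `+∞` if this never happens) when `x(τ) ≠ 0`, and `τ + T` when
`x(τ) = 0`. -/
def triggerTime (D : NominalDesign n m l) (T : ℝ) (a : Vec n → ℝ) (s : EReal)
    (x : ℝ → Vec n) (ϑ : ℝ → Vec l) (τ : ℝ) : EReal :=
  open Classical in
  if x τ = 0 then ((τ + T : ℝ) : EReal)
  else sInf ((fun t : ℝ => (t : EReal)) ''
    {t : ℝ | τ < t ∧ (t : EReal) < s ∧ D.V (ϑ τ) (x t) = D.Q (ϑ τ) (x τ) + a (x τ)})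

/-- `(x, ϑ)` with event times `τ 0 < τ 1 < …` is a solution on `[0, s)`, where `s ≤ +∞`, of the
hybrid closed loop (plant with true parameter `θ`, certainty-equivalence feedback, event trigger,
least-squares update) with initial data `x₀, ϑ₀`.  Values at times outside `[0, s)`, and event
times `≥ s`, are irrelevant. -/
structure IsHybridSolution (P : Plant n m l) (D : NominalDesign n m l) (T : ℝ) (a : Vec n → ℝ)
    (Nt : ℕ) (θ : Vec l) (x₀ : Vec n) (ϑ₀ : Vec l) (s : EReal)
    (x : ℝ → Vec n) (ϑ : ℝ → Vec l) (τ : ℕ → ℝ) : Prop where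
  x_init : x 0 = x₀
  estimate_init : ϑ 0 = ϑ₀
  event_zero : τ 0 = 0
  event_strictMono : StrictMono τ
  /-- The intervals `[τ i, τ (i+1))` cover the domain `[0, s)`. -/
  event_cover : ∀ t : ℝ, (t : EReal) < s → ∃ i, t < τ i
  /-- The next event takes place at `min (τ i + T, r i)`. -/
  event_next : ∀ i, (τ i : EReal) < s →
    (τ (i + 1) : EReal) = min ((τ i + T : ℝ) : EReal) (triggerTime D T a s x ϑ (τ i))
  x_continuous : ContinuousOn x {t : ℝ | 0 ≤ t ∧ (t : EReal) < s}
  /-- The plant equation between events, with `u(t) = k(ϑ(τ i), x(t))`; at `τ i` the derivative is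
  the right one. -/
  x_ode : ∀ i, ∀ t : ℝ, τ i ≤ t → t < τ (i + 1) → (t : EReal) < s →
    HasDerivWithinAt x (loopField P D θ (ϑ (τ i)) (x t))
      {r : ℝ | τ i ≤ r ∧ r < τ (i + 1) ∧ (r : EReal) < s} t
  /-- The estimate is constant between events. -/
  estimate_const : ∀ i, ∀ t : ℝ, τ i ≤ t → t < τ (i + 1) → (t : EReal) < s → ϑ t = ϑ (τ i)
  /-- At an event the new estimate is the point nearest to the old one among the solutions `γ` of
  `Z = G γ`, where the data are taken from the time `μ` on, `μ` being the earliest event time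
  before `τ (i+1)` which is not smaller than `τ (i+1) - Nt * T`. -/
  estimate_update : ∀ i, (τ (i + 1) : EReal) < s →
    ∃ μ : ℝ, IsLeast {r : ℝ | ∃ j, j ≤ i ∧ r = τ j ∧ τ (i + 1) - Nt * T ≤ τ j} μ ∧
      ϑ (τ (i + 1)) ∈ {γ : Vec l | dataZ P x (input D x ϑ) (τ (i + 1)) μ =
          gramG P x (input D x ϑ) (τ (i + 1)) μ γ} ∧
      IsMinOn (fun γ : Vec l => ‖γ - ϑ (τ i)‖ ^ 2)
        {γ : Vec l | dataZ P x (input D x ϑ) (τ (i + 1)) μ =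
          gramG P x (input D x ϑ) (τ (i + 1)) μ γ} (ϑ (τ (i + 1)))

end RegAdaptive

end

open RegAdaptive

/-! Integrating the plant equation over a data window gives `p(t, σ) = q(t, σ) θ`, hence `Z = G θ`.
The solutions `γ` of `Z = G γ` therefore form the affine space `θ + ker G`. Since `⟨v, G v⟩` is the
double integral of `|q(t, σ) v|²`, the kernel `W` of `G` consists of the vectors annihilated by
`g(x(t), u(t))` on every piece of the window (`dataZ_eq_gramG_iff`). The least-squares update thus
replaces the error `ϑ - θ` by its orthogonal projection onto `W` (`isUpdate_iff`). The error norm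
never grows, a zero error stays zero, and the new error lies in `W`.

Because `N < Nt` and consecutive events are at most `T` apart, the first `N` windows reach back to
time `0`. If the estimate were still wrong at the event `N`, all earlier errors would be nonzero
too, and the errors could serve as the `d i` of parameter observability, which then forces `x = 0`
(`estimate_eq_of_observability`). So for `x₀ ≠ 0` the estimate is exact after `N` events, that is by
time `N * T`. From then on `V ≤ Q < Q + a` away from the origin, no event is triggered early, events
are spaced by `T` and cannot accumulate, and the solution is global. For `x₀ = 0` the state stays at
the origin and the spacing is `T` from the start.

For the bound, all estimates stay in the compact ball of radius `‖ϑ₀ - θ‖` about `θ`, and `V ≤ Q +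
a` holds between events. Uniform coercivity turns this into boundedness and smallness of the state
over one interval, and induction over `N` intervals does it up to `τ N`. Afterwards the state
follows the nominal flow (`exists_forwardSolution_tail`), which is uniformly attractive. Uniform
boundedness, smallness and attraction yield a `KL` bound: take suprema over tails, then average in
time and in size to gain continuity (`exists_classKL_bound`).

The hybrid rules are handled through `IsStep`, which involves the trajectory only up to the next
event. Existence glues steps recursively, and uniqueness compares steps one after the other. -/

/-! ## Ordinary differential equations -/

namespace RegAdaptive

variable {n m l : ℕ}

/-- `x` is continuous on `[a, b]` and has right derivative `F (x t)` at all `t ∈ [a, b)`. -/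
structure SolvesOn (F : Vec n → Vec n) (x : ℝ → Vec n) (a b : ℝ) : Prop where
  cont : ContinuousOn x (Icc a b)
  deriv : ∀ t ∈ Ico a b, HasDerivWithinAt x (F (x t)) (Ici t) t

theorem SolvesOn.mono {F : Vec n → Vec n} {x : ℝ → Vec n} {a b c d : ℝ} (h : SolvesOn F x a b)
    (hac : a ≤ c) (hdb : d ≤ b) : SolvesOn F x c d :=
  ⟨h.cont.mono (Icc_subset_Icc hac hdb), fun t ht => h.deriv t (Ico_subset_Ico hac hdb ht)⟩

theorem SolvesOn.shift {F : Vec n → Vec n} {x : ℝ → Vec n} {a b : ℝ} (h : SolvesOn F x a b)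
    (c : ℝ) : SolvesOn F (fun t => x (c + t)) (a - c) (b - c) := by
  refine ⟨h.cont.comp (by fun_prop) fun t ht => ?_, fun t ht => ?_⟩
  · constructor <;> [linarith [ht.1]; linarith [ht.2]]
  · have h1 := h.deriv (c + t) ⟨by linarith [ht.1], by linarith [ht.2]⟩
    have h2 : HasDerivWithinAt (fun t : ℝ => c + t) 1 (Ici t) t :=
      ((hasDerivAt_id t).const_add c).hasDerivWithinAt
    have := h1.scomp t h2 (fun r hr => by simpa using hr)
    simpa using! this

theorem SolvesOn.trans {F : Vec n → Vec n} {x : ℝ → Vec n} {a b c : ℝ} (h : SolvesOn F x a b)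
    (h' : SolvesOn F x b c) (hab : a ≤ b) (hbc : b ≤ c) : SolvesOn F x a c := by
  refine ⟨?_, fun t ht => ?_⟩
  · rw [← Icc_union_Icc_eq_Icc hab hbc]
    exact h.cont.union_of_isClosed h'.cont isClosed_Icc isClosed_Icc
  · rcases lt_or_ge t b with h1 | h1
    · exact h.deriv t ⟨ht.1, h1⟩
    · exact h'.deriv t ⟨h1, ht.2⟩

theorem IsForwardSolution.solvesOn {F : Vec n → Vec n} {x : ℝ → Vec n}
    (h : IsForwardSolution F x) (b : ℝ) : SolvesOn F x 0 b :=
  ⟨fun t ht => ((h t ht.1).continuousWithinAt).mono fun _ hr => hr.1,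
    fun t ht => (h t ht.1).mono fun _ hr => le_trans ht.1 hr⟩

theorem SolvesOn.exists_norm_le {F : Vec n → Vec n} {x : ℝ → Vec n} {a b : ℝ}
    (h : SolvesOn F x a b) : ∃ R, ∀ t ∈ Icc a b, ‖x t‖ ≤ R :=
  isCompact_Icc.exists_bound_of_continuousOn h.cont

theorem exists_lipschitzOnWith_closedBall {F : Vec n → Vec n} (hF : ContDiff ℝ 1 F) (R : ℝ) :
    ∃ K, LipschitzOnWith K F (Metric.closedBall 0 R) :=
  hF.contDiffOn.exists_lipschitzOnWith one_ne_zero (convex_closedBall 0 R)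
    (isCompact_closedBall 0 R)

/-- Both trajectories stay in one ball on a compact interval, and a `C¹` field is Lipschitz there,
so Grönwall uniqueness applies although `F` need not be globally Lipschitz. -/
theorem SolvesOn.eqOn {F : Vec n → Vec n} (hF : ContDiff ℝ 1 F) {x y : ℝ → Vec n} {a b : ℝ}
    (hx : SolvesOn F x a b) (hy : SolvesOn F y a b) (h : x a = y a) : EqOn x y (Icc a b) := by
  obtain ⟨R, hR⟩ := hx.exists_norm_le
  obtain ⟨R', hR'⟩ := hy.exists_norm_le
  obtain ⟨K, hK⟩ := exists_lipschitzOnWith_closedBall hF (max R R')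
  exact ODE_solution_unique_of_mem_Icc_right (v := fun _ => F)
    (s := fun _ => Metric.closedBall 0 (max R R')) (fun _ _ => hK) hx.cont hx.deriv
    (fun t ht => by simpa using Or.inl (hR t (Ico_subset_Icc_self ht))) hy.cont hy.deriv
    (fun t ht => by simpa using Or.inr (hR' t (Ico_subset_Icc_self ht))) h

/-- A `C¹` compactly supported field has solutions on every compact interval. -/
theorem exists_solution_of_hasCompactSupport {F : Vec n → Vec n} (hF : ContDiff ℝ 1 F)
    (hc : HasCompactSupport F) (ξ : Vec n) {a b : ℝ} (hab : a ≤ b) :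
    ∃ z : ℝ → Vec n, z a = ξ ∧
      ∀ t ∈ Icc a b, HasDerivWithinAt z (F (z t)) (Icc a b) t := by
  obtain ⟨K, hK⟩ := hF.lipschitzWith_of_hasCompactSupport hc one_ne_zero
  obtain ⟨L, hL⟩ := hc.exists_bound_of_continuous hF.continuous
  have hL0 : 0 ≤ L := (norm_nonneg _).trans (hL 0)
  lift L to NNReal using hL0
  -- The radius `L * (b - a)` is the furthest a trajectory of speed at most `L` can travel, so no
  -- shrinking of the time interval is needed.
  have : IsPicardLindelof (fun _ => F) (⟨a, le_refl a, hab⟩ : Icc a b) ξ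
      (L * (b - a).toNNReal) 0 L K :=
    { lipschitzOnWith := fun t _ => hK.lipschitzOnWith
      continuousOn := fun _ _ => continuousOn_const
      norm_le := fun t _ x _ => hL x
      mul_max_le := by simp [hab] }
  exact this.exists_eq_forall_mem_Icc_hasDerivWithinAt₀

/-- A solution starting in the open sublevel set `{V < c}` exists up to a given time or up to the
first time at which `V` reaches the value `c`. -/
theorem exists_solution_until_exit {F : Vec n → Vec n} (hF : ContDiff ℝ 1 F) {V : Vec n → ℝ}
    (hV : Continuous V) {c : ℝ} (hc : IsCompact {x | V x ≤ c}) {ξ : Vec n} (hξ : V ξ < c)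
    {a b : ℝ} (hab : a < b) :
    ∃ (z : ℝ → Vec n) (r : ℝ), a < r ∧ r ≤ b ∧ z a = ξ ∧ ContinuousOn z (Icc a r) ∧
      (∀ t ∈ Ico a r, HasDerivWithinAt z (F (z t)) (Ico a r) t) ∧
      (∀ t ∈ Ico a r, V (z t) ≠ c) ∧ (r = b ∨ V (z r) = c) := by
  obtain ⟨R, hR0, hR⟩ : ∃ R : ℝ, 0 < R ∧ {x | V x ≤ c} ⊆ Metric.closedBall 0 R := by
    obtain ⟨R, hR⟩ := hc.isBounded.subset_closedBall 0
    exact ⟨max R 1, by positivity, hR.trans (Metric.closedBall_subset_closedBall (le_max_left _ _))⟩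
  -- The cut-off field has global solutions and agrees with `F` on `{V ≤ c}`, where the trajectory
  -- remains until `r`.
  let χ : ContDiffBump (0 : Vec n) := ⟨R, R + 1, hR0, by linarith⟩
  have hχ : ContDiff ℝ 1 (χ : Vec n → ℝ) := χ.contDiff
  obtain ⟨z, hz0, hz⟩ := exists_solution_of_hasCompactSupport (F := fun x => χ x • F x)
    (hχ.smul hF) χ.hasCompactSupport.smul_right ξ hab.le
  have hzc : ContinuousOn z (Icc a b) := fun t ht => (hz t ht).continuousWithinAt
  have hVz : ContinuousOn (fun t => V (z t)) (Icc a b) := hV.comp_continuousOn hzc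
  obtain ⟨r, har, hrb, hne, hr⟩ : ∃ r, a < r ∧ r ≤ b ∧ (∀ t ∈ Ico a r, V (z t) ≠ c) ∧
      (r = b ∨ V (z r) = c) := by
    by_cases hex : ∃ t ∈ Icc a b, V (z t) = c
    · have hcl : IsCompact (Icc a b ∩ (fun t => V (z t)) ⁻¹' {c}) :=
        isCompact_Icc.of_isClosed_subset (hVz.preimage_isClosed_of_isClosed isClosed_Icc
          isClosed_singleton) inter_subset_left
      obtain ⟨r, ⟨hr, hrc⟩, hmin⟩ := hcl.exists_isLeast (by
        obtain ⟨t, ht, h⟩ := hex; exact ⟨t, ht, h⟩)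
      have hrc' : V (z r) = c := hrc
      refine ⟨r, lt_of_le_of_ne hr.1 ?_, hr.2, fun t ht h => ?_, Or.inr hrc'⟩
      · rintro rfl
        rw [hz0] at hrc'; exact hξ.ne hrc'
      · exact absurd (hmin ⟨⟨ht.1, ht.2.le.trans hr.2⟩, h⟩) (not_le.2 ht.2)
    · push Not at hex
      exact ⟨b, hab, le_rfl, fun t ht => hex t (Ico_subset_Icc_self ht), Or.inl rfl⟩
  have hlt : ∀ t ∈ Ico a r, V (z t) < c := by
    intro t ht
    by_contra! hge
    have hsub : Icc a t ⊆ Icc a b := Icc_subset_Icc le_rfl (ht.2.le.trans hrb)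
    obtain ⟨s, hs, hsc⟩ := intermediate_value_Icc ht.1 (hVz.mono hsub)
      (⟨by simpa [hz0] using hξ.le, hge⟩ : c ∈ Icc (V (z a)) (V (z t)))
    exact hne s ⟨hs.1, hs.2.trans_lt ht.2⟩ hsc
  refine ⟨z, r, har, hrb, hz0, hzc.mono (Icc_subset_Icc le_rfl hrb), fun t ht => ?_, hne, hr⟩
  have h1 : χ (z t) = 1 := χ.one_of_mem_closedBall (hR (hlt t ht).le)
  have h2 : HasDerivWithinAt z (χ (z t) • F (z t)) (Ico a r) t :=
    (hz t ⟨ht.1, ht.2.le.trans hrb⟩).mono fun s hs => ⟨hs.1, hs.2.le.trans hrb⟩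
  simpa [h1] using h2

theorem hasDerivWithinAt_Ici_of_Ico {x : ℝ → Vec n} {v : Vec n} {a b t : ℝ} (ht : t ∈ Ico a b)
    (h : HasDerivWithinAt x v (Ico a b) t) : HasDerivWithinAt x v (Ici t) t :=
  (h.mono (Ico_subset_Ico_left ht.1)).mono_of_mem_nhdsWithin (Ico_mem_nhdsGE ht.2)

/-- Solutions which start in a bounded set and stay bounded are attracted uniformly. -/
theorem IsGAS.uniformly_attractive {F : Vec n → Vec n} (hF : ContDiff ℝ 1 F) (h : IsGAS F)
    (hb : ∀ s : ℝ, ∃ B : ℝ, ∀ z, IsForwardSolution F z → ‖z 0‖ ≤ s → ∀ t, 0 ≤ t → ‖z t‖ ≤ B)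
    (s ε : ℝ) (hε : 0 < ε) :
    ∃ T : ℝ, 0 ≤ T ∧ ∀ z, IsForwardSolution F z → ‖z 0‖ ≤ s → ∀ t, T ≤ t → ‖z t‖ ≤ ε := by
  obtain ⟨δ, hδ, hstab⟩ := h.stable ε hε
  choose Φ hΦ hΦ0 using h.complete
  obtain ⟨B, hB⟩ := hb (s + 1)
  obtain ⟨K, hK⟩ := exists_lipschitzOnWith_closedBall hF B
  have hpoint : ∀ ξ : Vec n, ∃ T : ℝ, 0 ≤ T ∧ ‖Φ ξ T‖ < δ / 2 := by
    intro ξ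
    have h1 := (h.attractive _ (hΦ ξ)).norm
    rw [norm_zero] at h1
    obtain ⟨T, hT0, hT⟩ := ((eventually_ge_atTop 0).and
      (h1.eventually (gt_mem_nhds (half_pos hδ)))).exists
    exact ⟨T, hT0, hT⟩
  choose τ hτ0 hτ using hpoint
  -- The reference solution from `ξ` is within `δ / 2` of the origin at time `τ ξ`. By Grönwall,
  -- solutions starting close enough to `ξ` are then within `δ`, and stability keeps them within `ε`
  -- afterwards. Compactness leaves finitely many `ξ`.
  have hnear : ∀ ξ ∈ Metric.closedBall (0 : Vec n) s,
      {y | ∀ z, IsForwardSolution F z → z 0 = y → ‖y‖ ≤ s → ∀ t, τ ξ ≤ t → ‖z t‖ ≤ ε} ∈ 𝓝 ξ := by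
    intro ξ hξ
    rw [mem_closedBall_zero_iff] at hξ
    have he : 0 < Real.exp (K * τ ξ) := Real.exp_pos _
    refine Filter.mem_of_superset (Metric.ball_mem_nhds ξ
      (show 0 < δ / 2 / Real.exp (K * τ ξ) by positivity)) fun y hy z hz hzy hys t ht => ?_
    have hz0 : ‖z 0‖ ≤ s + 1 := by rw [hzy]; linarith
    have hd : dist (z (τ ξ)) (Φ ξ (τ ξ)) < δ / 2 := by
      have := dist_le_of_trajectories_ODE_of_mem (v := fun _ => F)
        (s := fun _ => Metric.closedBall 0 B) (fun _ _ => hK) (hz.solvesOn (τ ξ)).cont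
        (hz.solvesOn (τ ξ)).deriv (fun t ht => by simpa using hB z hz hz0 t ht.1)
        ((hΦ ξ).solvesOn (τ ξ)).cont ((hΦ ξ).solvesOn (τ ξ)).deriv
        (fun t ht => by simpa using hB _ (hΦ ξ) (by rw [hΦ0]; linarith) t ht.1) le_rfl (τ ξ)
        ⟨hτ0 ξ, le_rfl⟩
      rw [hzy, hΦ0, sub_zero] at this
      refine this.trans_lt ?_
      rwa [← lt_div_iff₀ he]
    have hsmall : ‖z (τ ξ)‖ < δ := by
      calc ‖z (τ ξ)‖ ≤ dist (z (τ ξ)) (Φ ξ (τ ξ)) + ‖Φ ξ (τ ξ)‖ := by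
            rw [dist_eq_norm]; simpa using norm_add_le (z (τ ξ) - Φ ξ (τ ξ)) (Φ ξ (τ ξ))
        _ < δ := by linarith [hτ ξ]
    have hshift : IsForwardSolution F (fun t => z (τ ξ + t)) := by
      intro r hr
      have h1 := hz (τ ξ + r) (add_nonneg (hτ0 ξ) hr)
      have h2 : HasDerivWithinAt (fun t : ℝ => τ ξ + t) 1 (Ici 0) r :=
        ((hasDerivAt_id r).const_add (τ ξ)).hasDerivWithinAt
      have := h1.scomp r h2 (fun q hq => add_nonneg (hτ0 ξ) hq)
      simpa using! this
    have := hstab _ hshift (by simpa using hsmall) (t - τ ξ) (by linarith)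
    simpa using this.le
  obtain ⟨I, hI, hcover⟩ := (isCompact_closedBall (0 : Vec n) s).elim_nhds_subcover _ hnear
  refine ⟨∑ ξ ∈ I, τ ξ, Finset.sum_nonneg fun ξ _ => hτ0 ξ, fun z hz hz0 t ht => ?_⟩
  have hmem := hcover (mem_closedBall_zero_iff.2 hz0)
  simp only [mem_iUnion] at hmem
  obtain ⟨ξ, hξ, hmem⟩ := hmem
  exact hmem z hz rfl hz0 t
    ((Finset.single_le_sum (fun ξ _ => hτ0 ξ) hξ).trans ht)

end RegAdaptive

/-! ## Comparison functions -/

namespace RegAdaptive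

open intervalIntegral MeasureTheory

/-- A family of bounds, monotone in the size `s` and antitone in the time `t`, which tends to zero
for large times and for small sizes. -/
structure IsDecayProfile (M : ℝ → ℝ → ℝ) : Prop where
  mono : ∀ t, Monotone fun s => M s t
  anti : ∀ s, Antitone (M s)
  nonneg : ∀ s t, 0 ≤ M s t
  le_zero : ∀ s t, M s t ≤ M s 0
  tendsto_atTop : ∀ s, Tendsto (M s) atTop (𝓝 0)
  tendsto_size : ∀ ε : ℝ, 0 < ε → ∃ δ : ℝ, 0 < δ ∧ M δ 0 ≤ ε

/-- Average of `M s` over the unit time interval before `t`. -/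
noncomputable def timeAverage (M : ℝ → ℝ → ℝ) (s t : ℝ) : ℝ := ∫ w in (0 : ℝ)..1, M s (t - w)

/-- Average of `timeAverage M` over sizes between `s` and `2 s`. -/
noncomputable def sizeAverage (M : ℝ → ℝ → ℝ) (s t : ℝ) : ℝ :=
  ∫ w in (1 : ℝ)..2, timeAverage M (s * w) t

namespace IsDecayProfile

variable {M : ℝ → ℝ → ℝ}

theorem integrable_time (h : IsDecayProfile M) (s t a b : ℝ) :
    IntervalIntegrable (fun w => M s (t - w)) volume a b :=
  Monotone.intervalIntegrable fun _ _ hw => h.anti s (sub_le_sub_left hw t)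

theorem timeAverage_mono (h : IsDecayProfile M) (t : ℝ) : Monotone fun s => timeAverage M s t :=
  fun s s' hs => integral_mono_on zero_le_one (h.integrable_time s t 0 1)
    (h.integrable_time s' t 0 1) fun w _ => h.mono (t - w) hs

theorem timeAverage_anti (h : IsDecayProfile M) (s : ℝ) : Antitone (timeAverage M s) :=
  fun t t' ht => integral_mono_on zero_le_one (h.integrable_time s t' 0 1)
    (h.integrable_time s t 0 1) fun w _ => h.anti s (sub_le_sub_right ht w)

theorem le_timeAverage (h : IsDecayProfile M) (s t : ℝ) : M s t ≤ timeAverage M s t := by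
  have := integral_mono_on (f := fun _ : ℝ => M s t) zero_le_one intervalIntegrable_const
    (h.integrable_time s t 0 1) fun w hw => h.anti s (by linarith [hw.1] : t - w ≤ t)
  simpa [timeAverage] using this

theorem timeAverage_le (h : IsDecayProfile M) (s t : ℝ) : timeAverage M s t ≤ M s (t - 1) := by
  have := integral_mono_on (g := fun _ : ℝ => M s (t - 1)) zero_le_one
    (h.integrable_time s t 0 1) intervalIntegrable_const
    fun w hw => h.anti s (by linarith [hw.2] : t - 1 ≤ t - w)
  simpa [timeAverage] using this

/-- Shifting the averaging window only exchanges two end pieces of length `t' - t`. This Lipschitz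
bound holds even where `M s` jumps. -/
theorem timeAverage_sub_le (h : IsDecayProfile M) (s : ℝ) {t t' : ℝ} (ht : t ≤ t') :
    timeAverage M s t - timeAverage M s t' ≤ M s 0 * (t' - t) := by
  have hi : ∀ a b, IntervalIntegrable (M s) volume a b := fun a b => (h.anti s).intervalIntegrable
  have e : ∀ r, timeAverage M s r = ∫ v in (r - 1)..r, M s v := fun r => by
    simp [timeAverage]
  rw [e, e]
  have h1 : (∫ v in (t - 1)..t, M s v) - ∫ v in (t' - 1)..t', M s v
      = (∫ v in (t - 1)..(t' - 1), M s v) - ∫ v in t..t', M s v := by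
    rw [integral_interval_sub_interval_comm (hi _ _) (hi _ _) (hi _ _)]
  have h2 : ∫ v in (t - 1)..(t' - 1), M s v ≤ M s 0 * (t' - t) := by
    have := integral_mono_on (g := fun _ : ℝ => M s 0) (by linarith : t - 1 ≤ t' - 1)
      (hi _ _) intervalIntegrable_const fun w _ => h.le_zero s w
    simpa [mul_comm] using this
  have h3 : 0 ≤ ∫ v in t..t', M s v := integral_nonneg ht fun w _ => h.nonneg s w
  linarith

theorem integrable_size (h : IsDecayProfile M) {s : ℝ} (hs : 0 ≤ s) (t a b : ℝ) :
    IntervalIntegrable (fun w => timeAverage M (s * w) t) volume a b :=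
  Monotone.intervalIntegrable fun _ _ hw => h.timeAverage_mono t (mul_le_mul_of_nonneg_left hw hs)

theorem sizeAverage_mono (h : IsDecayProfile M) (t : ℝ) :
    MonotoneOn (fun s => sizeAverage M s t) (Ici 0) :=
  fun s hs s' hs' hss => integral_mono_on one_le_two (h.integrable_size hs t 1 2)
    (h.integrable_size hs' t 1 2) fun w hw =>
      h.timeAverage_mono t (mul_le_mul_of_nonneg_right hss (by linarith [hw.1]))

theorem sizeAverage_anti (h : IsDecayProfile M) {s : ℝ} (hs : 0 ≤ s) :
    Antitone (sizeAverage M s) :=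
  fun t t' ht => integral_mono_on one_le_two (h.integrable_size hs t' 1 2)
    (h.integrable_size hs t 1 2) fun w _ => h.timeAverage_anti (s * w) ht

theorem le_sizeAverage (h : IsDecayProfile M) {s : ℝ} (hs : 0 ≤ s) (t : ℝ) :
    M s t ≤ sizeAverage M s t := by
  have := integral_mono_on (f := fun _ : ℝ => timeAverage M s t) one_le_two
    intervalIntegrable_const (h.integrable_size hs t 1 2)
    fun w hw => h.timeAverage_mono t (le_mul_of_one_le_right hs hw.1)
  refine (h.le_timeAverage s t).trans ?_
  norm_num at this
  simpa [sizeAverage] using this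

theorem sizeAverage_le (h : IsDecayProfile M) {s : ℝ} (hs : 0 ≤ s) (t : ℝ) :
    sizeAverage M s t ≤ M (2 * s) (t - 1) := by
  have := integral_mono_on (g := fun _ : ℝ => timeAverage M (2 * s) t) one_le_two
    (h.integrable_size hs t 1 2) intervalIntegrable_const
    fun w hw => h.timeAverage_mono t (by nlinarith [hw.2] : s * w ≤ 2 * s)
  refine le_trans ?_ (h.timeAverage_le (2 * s) t)
  norm_num at this
  simpa [sizeAverage] using this

theorem sizeAverage_nonneg (h : IsDecayProfile M) {s : ℝ} (hs : 0 ≤ s) (t : ℝ) :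
    0 ≤ sizeAverage M s t := (h.nonneg s t).trans (h.le_sizeAverage hs t)

theorem sizeAverage_sub_le (h : IsDecayProfile M) {s : ℝ} (hs : 0 ≤ s) {t t' : ℝ} (ht : t ≤ t') :
    sizeAverage M s t - sizeAverage M s t' ≤ M (2 * s) 0 * (t' - t) := by
  rw [sizeAverage, sizeAverage, ← integral_sub (h.integrable_size hs t 1 2)
    (h.integrable_size hs t' 1 2)]
  have := integral_mono_on (g := fun _ : ℝ => M (2 * s) 0 * (t' - t)) one_le_two
    ((h.integrable_size hs t 1 2).sub (h.integrable_size hs t' 1 2)) intervalIntegrable_const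
    fun w hw => (h.timeAverage_sub_le (s * w) ht).trans (mul_le_mul_of_nonneg_right
      (h.mono 0 (by nlinarith [hw.2] : s * w ≤ 2 * s)) (sub_nonneg.2 ht))
  norm_num at this
  simpa using this

theorem abs_sizeAverage_sub_le (h : IsDecayProfile M) {s : ℝ} (hs : 0 ≤ s) (t t' : ℝ) :
    |sizeAverage M s t - sizeAverage M s t'| ≤ M (2 * s) 0 * |t - t'| := by
  rcases le_total t t' with ht | ht
  · rw [abs_of_nonneg (sub_nonneg.2 (h.sizeAverage_anti hs ht)), abs_sub_comm,
      abs_of_nonneg (sub_nonneg.2 ht)]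
    exact h.sizeAverage_sub_le hs ht
  · rw [abs_sub_comm, abs_of_nonneg (sub_nonneg.2 (h.sizeAverage_anti hs ht)),
      abs_of_nonneg (sub_nonneg.2 ht)]
    exact h.sizeAverage_sub_le hs ht

theorem sizeAverage_zero (h : IsDecayProfile M) (t : ℝ) : sizeAverage M 0 t = 0 := by
  refine le_antisymm ?_ (h.sizeAverage_nonneg le_rfl t)
  refine (h.sizeAverage_le le_rfl t).trans ((h.le_zero _ _).trans (le_of_forall_pos_le_add ?_))
  intro ε hε
  obtain ⟨δ, hδ, hM⟩ := h.tendsto_size ε hε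
  rw [zero_add, mul_zero]
  exact (h.mono 0 hδ.le).trans hM

/-- At `s = 0` the average is squeezed by `M (2 * s) 0`. For `s > 0` the substitution `v = s * w`
writes it as `s⁻¹` times a difference of primitives of a monotone function. -/
theorem sizeAverage_continuousOn (h : IsDecayProfile M) (t : ℝ) :
    ContinuousOn (fun s => sizeAverage M s t) (Ici 0) := by
  intro s hs
  rcases eq_or_lt_of_le (show (0 : ℝ) ≤ s from hs) with rfl | hs
  · rw [ContinuousWithinAt, h.sizeAverage_zero, Metric.tendsto_nhdsWithin_nhds]
    intro ε hε
    obtain ⟨δ, hδ, hM⟩ := h.tendsto_size (ε / 2) (half_pos hε)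
    refine ⟨δ / 2, half_pos hδ, fun r hr hd => ?_⟩
    have hr : 0 ≤ r := hr
    rw [Real.dist_0_eq_abs] at hd ⊢
    rw [abs_of_nonneg hr] at hd
    rw [abs_of_nonneg (h.sizeAverage_nonneg hr t)]
    calc sizeAverage M r t ≤ M (2 * r) (t - 1) := h.sizeAverage_le hr t
      _ ≤ M (2 * r) 0 := h.le_zero _ _
      _ ≤ M δ 0 := h.mono 0 (by linarith)
      _ < ε := by linarith
  · refine ContinuousAt.continuousWithinAt ?_
    have hi : ∀ a b, IntervalIntegrable (fun r => timeAverage M r t) volume a b :=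
      fun a b => (h.timeAverage_mono t).intervalIntegrable
    have hp := continuous_primitive hi 0
    have hq : ContinuousAt (fun r : ℝ => r⁻¹ * ((∫ v in (0 : ℝ)..(r * 2), timeAverage M v t) -
        ∫ v in (0 : ℝ)..r, timeAverage M v t)) s := by
      refine (continuousAt_inv₀ hs.ne').mul (ContinuousAt.sub ?_ hp.continuousAt)
      exact (hp.comp (continuous_mul_const (2 : ℝ))).continuousAt
    refine hq.congr ?_
    filter_upwards [lt_mem_nhds hs] with r hr
    rw [integral_interval_sub_left (hi _ _) (hi _ _), sizeAverage,
      integral_comp_mul_left (fun v => timeAverage M v t) hr.ne', mul_one, smul_eq_mul]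

/-- Continuity in the size is combined with a Lipschitz constant in time that is uniform for sizes
below `s + 1`. -/
theorem sizeAverage_jointly_continuousOn (h : IsDecayProfile M) :
    ContinuousOn (fun p : ℝ × ℝ => sizeAverage M p.1 p.2) (Ici 0 ×ˢ Ici 0) := by
  rintro ⟨s, t⟩ ⟨hs, ht⟩
  rw [ContinuousWithinAt, tendsto_iff_dist_tendsto_zero]
  have hlim : Tendsto (fun p : ℝ × ℝ => M (2 * (s + 1)) 0 * |p.2 - t| +
      |sizeAverage M p.1 t - sizeAverage M s t|) (𝓝[Ici 0 ×ˢ Ici 0] (s, t)) (𝓝 0) := by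
    have h1 : Tendsto (fun p : ℝ × ℝ => M (2 * (s + 1)) 0 * |p.2 - t|)
        (𝓝[Ici 0 ×ˢ Ici 0] (s, t)) (𝓝 0) := by
      have : Continuous (fun p : ℝ × ℝ => M (2 * (s + 1)) 0 * |p.2 - t|) := by fun_prop
      simpa using! (this.tendsto (s, t)).mono_left nhdsWithin_le_nhds
    have h2 : Tendsto (fun p : ℝ × ℝ => |sizeAverage M p.1 t - sizeAverage M s t|)
        (𝓝[Ici 0 ×ˢ Ici 0] (s, t)) (𝓝 0) := by
      have hc : ContinuousWithinAt (fun p : ℝ × ℝ => sizeAverage M p.1 t) (Ici 0 ×ˢ Ici 0) (s, t) :=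
        ContinuousWithinAt.comp (g := fun r => sizeAverage M r t) (f := Prod.fst) (t := Ici 0)
          (h.sizeAverage_continuousOn t s hs) continuousWithinAt_fst fun p hp => hp.1
      simpa using! (hc.sub_const (sizeAverage M s t)).abs
    simpa using h1.add h2
  refine squeeze_zero' (Eventually.of_forall fun _ => dist_nonneg) ?_ hlim
  have hev : ∀ᶠ p : ℝ × ℝ in 𝓝[Ici 0 ×ˢ Ici 0] (s, t), p.1 < s + 1 :=
    nhdsWithin_le_nhds (continuous_fst.continuousAt.eventually (gt_mem_nhds (lt_add_one s)))
  filter_upwards [hev, self_mem_nhdsWithin] with p hp hp0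
  have hp1 : 0 ≤ p.1 := hp0.1
  rw [Real.dist_eq]
  refine (abs_sub_le _ (sizeAverage M p.1 t) _).trans (add_le_add_left ?_ _)
  exact (h.abs_sizeAverage_sub_le hp1 _ _).trans (mul_le_mul_of_nonneg_right
    (h.mono 0 (by linarith)) (abs_nonneg _))

theorem exists_classKL (h : IsDecayProfile M) :
    ∃ σ, IsClassKL σ ∧ ∀ s t, 0 ≤ s → M s t ≤ σ s t := by
  have hcont : ContinuousOn (fun p : ℝ × ℝ => sizeAverage M p.1 p.2 + p.1 * Real.exp (-p.2))
      (Ici 0 ×ˢ Ici 0) := h.sizeAverage_jointly_continuousOn.add (by fun_prop)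
  -- The average is only nondecreasing in `s`; the added term makes the sum strictly increasing and
  -- still decays in time.
  refine ⟨fun s t => sizeAverage M s t + s * Real.exp (-t), ⟨hcont, fun t ht => ⟨?_, ?_, ?_⟩,
    fun s hs => ?_, fun s hs => ?_⟩, fun s t hs => ?_⟩
  · exact hcont.comp (f := fun s : ℝ => (s, t)) (by fun_prop) fun s hs => ⟨hs, ht⟩
  · intro s hs s' hs' hss
    exact add_lt_add_of_le_of_lt (h.sizeAverage_mono t hs hs' hss.le)
      (mul_lt_mul_of_pos_right hss (Real.exp_pos _))
  · simp [h.sizeAverage_zero]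
  · intro t _ t' _ ht
    exact add_le_add (h.sizeAverage_anti hs ht)
      (mul_le_mul_of_nonneg_left (Real.exp_le_exp.2 (neg_le_neg ht)) hs)
  · have h1 : Tendsto (sizeAverage M s) atTop (𝓝 0) :=
      squeeze_zero (fun t => h.sizeAverage_nonneg hs t) (fun t => h.sizeAverage_le hs t)
        ((h.tendsto_atTop (2 * s)).comp (tendsto_atTop_add_const_right _ _ tendsto_id))
    have h2 : Tendsto (fun t => s * Real.exp (-t)) atTop (𝓝 (s * 0)) :=
      (Real.tendsto_exp_neg_atTop_nhds_zero).const_mul s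
    simpa using h1.add h2
  · have : 0 ≤ s * Real.exp (-t) := mul_nonneg hs (Real.exp_pos _).le
    linarith [h.le_sizeAverage hs t]

end IsDecayProfile

/-- A family of functions of time which is bounded, small and attracted to zero
uniformly for parameters of bounded size has a `KL` bound in terms of the size. -/
theorem exists_classKL_bound {ι : Type*} (size : ι → ℝ) (ψ : ι → ℝ → ℝ)
    (hsize : ∀ i, 0 ≤ size i)
    (hbdd : ∀ s : ℝ, ∃ B : ℝ, ∀ i, size i ≤ s → ∀ t, 0 ≤ t → ψ i t ≤ B)
    (hsmall : ∀ ε : ℝ, 0 < ε → ∃ δ : ℝ, 0 < δ ∧ ∀ i, size i ≤ δ → ∀ t, 0 ≤ t → ψ i t ≤ ε)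
    (hattr : ∀ s ε : ℝ, 0 < ε → ∃ T : ℝ, ∀ i, size i ≤ s → ∀ t, 0 ≤ t → T ≤ t → ψ i t ≤ ε) :
    ∃ σ, IsClassKL σ ∧ ∀ i t, 0 ≤ t → ψ i t ≤ σ (size i) t := by
  -- Including `0` keeps the set nonempty and its supremum nonnegative. The condition `0 ≤ r` gives
  -- sense to negative `t`, which the averages over past times reach.
  let A : ℝ → ℝ → Set ℝ := fun s t => {v | v = 0 ∨ ∃ i r, size i ≤ s ∧ 0 ≤ r ∧ t ≤ r ∧ v = ψ i r}
  have hzero : ∀ s t, (0 : ℝ) ∈ A s t := fun s t => Or.inl rfl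
  have hA : ∀ s t, BddAbove (A s t) := by
    intro s t
    obtain ⟨B, hB⟩ := hbdd s
    refine ⟨max 0 B, ?_⟩
    rintro v (rfl | ⟨i, r, hi, hr, -, rfl⟩)
    · exact le_max_left _ _
    · exact (hB i hi r hr).trans (le_max_right _ _)
  have hle : ∀ s t c, 0 ≤ c → (∀ i r, size i ≤ s → 0 ≤ r → t ≤ r → ψ i r ≤ c) →
      sSup (A s t) ≤ c := by
    intro s t c hc h
    refine csSup_le ⟨0, hzero s t⟩ ?_
    rintro v (rfl | ⟨i, r, hi, hr, htr, rfl⟩)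
    · exact hc
    · exact h i r hi hr htr
  have hnn : ∀ s t, 0 ≤ sSup (A s t) := fun s t => le_csSup (hA s t) (hzero s t)
  have hmem : ∀ s t i r, size i ≤ s → 0 ≤ r → t ≤ r → ψ i r ≤ sSup (A s t) :=
    fun s t i r hi hr htr => le_csSup (hA s t) (Or.inr ⟨i, r, hi, hr, htr, rfl⟩)
  have hM : IsDecayProfile fun s t => sSup (A s t) :=
    { mono := fun t s s' hs => hle _ _ _ (hnn _ _) fun i r hi => hmem _ _ _ _ (hi.trans hs)
      anti := fun s t t' ht => hle _ _ _ (hnn _ _) fun i r hi hr htr =>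
        hmem _ _ _ _ hi hr (ht.trans htr)
      nonneg := hnn
      le_zero := fun s t => hle _ _ _ (hnn _ _) fun i r hi hr _ => hmem _ _ _ _ hi hr hr
      tendsto_atTop := by
        intro s
        rw [Metric.tendsto_atTop]
        intro ε hε
        obtain ⟨T, hT⟩ := hattr s (ε / 2) (half_pos hε)
        refine ⟨T, fun t ht => ?_⟩
        rw [Real.dist_0_eq_abs, abs_of_nonneg (hnn s t)]
        exact (hle s t _ (half_pos hε).le fun i r hi hr htr =>
          hT i hi r hr (le_trans ht htr)).trans_lt (half_lt_self hε)
      tendsto_size := by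
        intro ε hε
        obtain ⟨δ, hδ, h⟩ := hsmall ε hε
        exact ⟨δ, hδ, hle _ _ _ hε.le fun i r hi hr _ => h i hi r hr⟩ }
  obtain ⟨σ, hσ, hMσ⟩ := hM.exists_classKL
  exact ⟨σ, hσ, fun i t ht => (hmem _ _ i t le_rfl ht le_rfl).trans (hMσ _ _ (hsize i))⟩

end RegAdaptive

/-! ## Least squares -/

namespace RegAdaptive

open intervalIntegral MeasureTheory

variable {n m l : ℕ}

/-! ### Gram operators of continuous families -/

theorem continuous_gram_integrand {Q : ℝ → (Vec l →L[ℝ] Vec n)} (hQ : Continuous Q) :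
    Continuous fun p : ℝ × ℝ =>
      (ContinuousLinearMap.adjoint (Q p.1 - Q p.2)).comp (Q p.1 - Q p.2) := by
  have h : Continuous fun p : ℝ × ℝ => Q p.1 - Q p.2 := by fun_prop
  exact (ContinuousLinearMap.adjoint.continuous.comp h).clm_comp h

theorem gram_apply {Q : ℝ → (Vec l →L[ℝ] Vec n)} (hQ : Continuous Q) (a b : ℝ) (v : Vec l) :
    (∫ t in a..b, ∫ σ in a..b, (ContinuousLinearMap.adjoint (Q t - Q σ)).comp (Q t - Q σ)) v =
      ∫ t in a..b, ∫ σ in a..b, ContinuousLinearMap.adjoint (Q t - Q σ) ((Q t - Q σ) v) := by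
  have hc := continuous_gram_integrand hQ
  rw [ContinuousLinearMap.intervalIntegral_apply]
  · congr 1 with t : 1
    rw [ContinuousLinearMap.intervalIntegral_apply]
    · rfl
    · exact (hc.comp (Continuous.prodMk_right t)).intervalIntegrable a b
  · exact (continuous_parametric_intervalIntegral_of_continuous' hc a b).intervalIntegrable a b

theorem inner_gram_apply {Q : ℝ → (Vec l →L[ℝ] Vec n)} (hQ : Continuous Q) (a b : ℝ) (v : Vec l) :
    inner ℝ v ((∫ t in a..b, ∫ σ in a..b,
      (ContinuousLinearMap.adjoint (Q t - Q σ)).comp (Q t - Q σ)) v) =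
      ∫ t in a..b, ∫ σ in a..b, ‖(Q t - Q σ) v‖ ^ 2 := by
  have hd : Continuous fun p : ℝ × ℝ =>
      ContinuousLinearMap.adjoint (Q p.1 - Q p.2) ((Q p.1 - Q p.2) v) :=
    (continuous_gram_integrand hQ).clm_apply continuous_const
  rw [gram_apply hQ, ← innerSL_apply_apply ℝ, ← ContinuousLinearMap.intervalIntegral_comp_comm]
  · congr 1 with t : 1
    rw [← ContinuousLinearMap.intervalIntegral_comp_comm]
    · congr 1 with σ : 1
      rw [innerSL_apply_apply, ContinuousLinearMap.adjoint_inner_right, real_inner_self_eq_norm_sq]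
    · exact (hd.comp (Continuous.prodMk_right t)).intervalIntegrable a b
  · exact (continuous_parametric_intervalIntegral_of_continuous' hd a b).intervalIntegrable a b

theorem eq_zero_of_integral_eq_zero {h : ℝ → ℝ} {a b : ℝ} (hab : a < b) (hc : Continuous h)
    (h0 : ∀ t, 0 ≤ h t) (hi : ∫ t in a..b, h t = 0) : ∀ t ∈ Icc a b, h t = 0 := by
  by_contra! hne
  obtain ⟨t, ht, hne⟩ := hne
  have := integral_pos hab hc.continuousOn (fun t _ => h0 t) ⟨t, ht, lt_of_le_of_ne (h0 t) hne.symm⟩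
  exact this.ne' hi

/-- Pairing with `v` turns the Gram operator into the integral of a continuous nonnegative function,
which vanishes only if the function does; this is used once for `t` and once for `σ`. -/
theorem gram_apply_eq_zero_iff {Q : ℝ → (Vec l →L[ℝ] Vec n)} (hQ : Continuous Q) {a b : ℝ}
    (hab : a < b) (v : Vec l) :
    (∫ t in a..b, ∫ σ in a..b, (ContinuousLinearMap.adjoint (Q t - Q σ)).comp (Q t - Q σ)) v = 0 ↔
      ∀ t ∈ Icc a b, ∀ σ ∈ Icc a b, (Q t - Q σ) v = 0 := by
  constructor
  · intro h t ht σ hσ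
    have h2 := inner_gram_apply hQ a b v
    rw [h, inner_zero_right] at h2
    have hc : Continuous fun p : ℝ × ℝ => ‖(Q p.1 - Q p.2) v‖ ^ 2 := by fun_prop
    have h3 := eq_zero_of_integral_eq_zero hab
      (continuous_parametric_intervalIntegral_of_continuous' hc a b)
      (fun t => integral_nonneg hab.le fun σ _ => by positivity) h2.symm t ht
    have h4 := eq_zero_of_integral_eq_zero hab (hc.comp (Continuous.prodMk_right t))
      (fun σ => sq_nonneg _) h3 σ hσ
    simpa using! h4
  · intro h
    rw [gram_apply hQ]
    have hz : ∀ t ∈ Icc a b, (∫ σ in a..b,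
        ContinuousLinearMap.adjoint (Q t - Q σ) ((Q t - Q σ) v)) = 0 := by
      intro t ht
      rw [integral_congr (g := fun _ => (0 : Vec l)), intervalIntegral.integral_zero]
      intro σ hσ
      rw [uIcc_of_le hab.le] at hσ
      simp only [h t ht σ hσ, map_zero]
    rw [integral_congr (g := fun _ => (0 : Vec l)), intervalIntegral.integral_zero]
    intro t ht
    rw [uIcc_of_le hab.le] at ht
    exact hz t ht

theorem eq_zero_of_forall_integral_eq_zero {h : ℝ → Vec n} {a b : ℝ} (hab : a < b)
    (hc : ContinuousOn h (Icc a b)) (hi : ∀ t ∈ Icc a b, ∫ s in a..t, h s = 0) :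
    ∀ t ∈ Icc a b, h t = 0 := by
  have key : ∀ t ∈ Ioo a b, h t = 0 := by
    intro t ht
    have h1 : HasDerivAt (fun r => ∫ s in a..r, h s) (h t) t := by
      refine integral_hasDerivAt_right ?_ ?_ (hc.continuousAt (Icc_mem_nhds ht.1 ht.2))
      · refine ContinuousOn.intervalIntegrable (hc.mono ?_)
        rw [uIcc_of_le ht.1.le]
        exact Icc_subset_Icc le_rfl ht.2.le
      · exact (hc.mono Ioo_subset_Icc_self).stronglyMeasurableAtFilter isOpen_Ioo t ht
    have h2 : HasDerivAt (fun r => ∫ s in a..r, h s) 0 t := by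
      refine (hasDerivAt_const t (0 : Vec n)).congr_of_eventuallyEq ?_
      filter_upwards [Ioo_mem_nhds ht.1 ht.2] with r hr
      exact hi r (Ioo_subset_Icc_self hr)
    exact h1.unique h2
  have : EqOn h 0 (Icc a b) := by
    refine EqOn.of_subset_closure key hc continuousOn_const Ioo_subset_Icc_self ?_
    rw [closure_Ioo hab.ne]
  exact this

/-! ### The pieces of a trajectory between events -/

/-- The plant equation and the constancy of the estimate between the events `j` and `j + 1`. -/
structure IsPiece (P : Plant n m l) (D : NominalDesign n m l) (θ : Vec l) (x : ℝ → Vec n)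
    (ϑ : ℝ → Vec l) (τ : ℕ → ℝ) (j : ℕ) : Prop where
  lt : τ j < τ (j + 1)
  cont : ContinuousOn x (Icc (τ j) (τ (j + 1)))
  deriv : ∀ t ∈ Ico (τ j) (τ (j + 1)),
    HasDerivWithinAt x (loopField P D θ (ϑ (τ j)) (x t)) (Ico (τ j) (τ (j + 1))) t
  const : ∀ t ∈ Ico (τ j) (τ (j + 1)), ϑ t = ϑ (τ j)

theorem continuous_k (D : NominalDesign n m l) (ϑ : Vec l) : Continuous (D.k ϑ) :=
  D.k_smooth.continuous.comp (Continuous.prodMk_right ϑ)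

theorem contDiff_loopField (P : Plant n m l) (D : NominalDesign n m l) (θ ϑ : Vec l) :
    ContDiff ℝ 1 (loopField P D θ ϑ) := by
  have hk : ContDiff ℝ ∞ (D.k ϑ) := D.k_smooth.comp (contDiff_prodMk_right ϑ)
  have hp : ContDiff ℝ ∞ fun x : Vec n => (x, D.k ϑ x) := contDiff_id.prodMk hk
  exact ((P.f_smooth.comp hp).add ((P.g_smooth.comp hp).clm_apply contDiff_const)).of_le
    (by exact_mod_cast le_top)

section

variable {P : Plant n m l} {D : NominalDesign n m l} {θ : Vec l} {x : ℝ → Vec n} {ϑ : ℝ → Vec l}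
  {τ : ℕ → ℝ}

theorem IsPiece.solvesOn {j : ℕ} (h : IsPiece P D θ x ϑ τ j) :
    SolvesOn (loopField P D θ (ϑ (τ j))) x (τ j) (τ (j + 1)) :=
  ⟨h.cont, fun t ht => hasDerivWithinAt_Ici_of_Ico ht (h.deriv t ht)⟩

theorem exists_piece {i j : ℕ} (hji : j ≤ i) {s : ℝ} (hs : τ j ≤ s) (hs' : s < τ i) :
    ∃ k, j ≤ k ∧ k < i ∧ s ∈ Ico (τ k) (τ (k + 1)) := by
  induction i, hji using Nat.le_induction with
  | base => exact absurd hs (not_le.2 hs')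
  | succ i hji ih =>
    rcases lt_or_ge s (τ i) with h | h
    · obtain ⟨k, h1, h2, h3⟩ := ih h
      exact ⟨k, h1, by omega, h3⟩
    · exact ⟨i, hji, by omega, h, hs'⟩

theorem event_le_event {i j : ℕ} (hji : j ≤ i)
    (hlt : ∀ k, j ≤ k → k < i → τ k < τ (k + 1)) : τ j ≤ τ i := by
  induction i, hji using Nat.le_induction with
  | base => exact le_rfl
  | succ i hji ih =>
    exact (ih fun k h1 h2 => hlt k h1 (by omega)).trans (hlt i hji (by omega)).le

theorem continuousOn_of_pieces {i j : ℕ} (hji : j ≤ i)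
    (hp : ∀ k, j ≤ k → k < i → IsPiece P D θ x ϑ τ k) : ContinuousOn x (Icc (τ j) (τ i)) := by
  induction i, hji using Nat.le_induction with
  | base => simp
  | succ i hji ih =>
    rw [← Icc_union_Icc_eq_Icc (event_le_event hji fun k h1 h2 => (hp k h1 (by omega)).lt)
      (hp i hji (by omega)).lt.le]
    exact (ih fun k h1 h2 => hp k h1 (by omega)).union_of_isClosed (hp i hji (by omega)).cont
      isClosed_Icc isClosed_Icc

/-- The input may jump at events, but on each open piece it agrees with a function continuous on the
closed piece. -/
theorem intervalIntegrable_of_pieces {E : Type*} [NormedAddCommGroup E] {i j : ℕ} (hji : j ≤ i)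
    (hp : ∀ k, j ≤ k → k < i → IsPiece P D θ x ϑ τ k) {h : Vec n × Vec m → E}
    (hh : Continuous h) :
    IntervalIntegrable (fun s => h (x s, input D x ϑ s)) volume (τ j) (τ i) := by
  refine IntervalIntegrable.trans_iterate_Ico hji fun k hk => ?_
  have hpk := hp k hk.1 hk.2
  have h1 : ContinuousOn (fun s => h (x s, D.k (ϑ (τ k)) (x s))) (Icc (τ k) (τ (k + 1))) :=
    hh.comp_continuousOn (hpk.cont.prodMk ((continuous_k D _).comp_continuousOn hpk.cont))
  rw [← uIcc_of_le hpk.lt.le] at h1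
  refine (h1.intervalIntegrable (μ := volume)).congr_uIoo ?_
  rw [uIoo_of_le hpk.lt.le]
  intro s hs
  simp only [input, hpk.const s (Ioo_subset_Ico_self hs)]

end

end RegAdaptive

/-! ### The normal equations along a trajectory -/

namespace RegAdaptive

open intervalIntegral MeasureTheory

variable {n m l : ℕ}

section

variable {P : Plant n m l} {D : NominalDesign n m l} {θ : Vec l} {x : ℝ → Vec n} {ϑ : ℝ → Vec l}
  {τ : ℕ → ℝ}

theorem sub_eq_integral_of_pieces {i j : ℕ} (hji : j ≤ i)
    (hp : ∀ k, j ≤ k → k < i → IsPiece P D θ x ϑ τ k) {t : ℝ} (ht : t ∈ Icc (τ j) (τ i)) :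
    x t - x (τ j) = (∫ s in (τ j)..t, P.f (x s, input D x ϑ s)) +
      (∫ s in (τ j)..t, P.g (x s, input D x ϑ s)) θ := by
  have hsub : uIcc (τ j) t ⊆ uIcc (τ j) (τ i) := by
    rw [uIcc_of_le ht.1, uIcc_of_le (ht.1.trans ht.2)]
    exact Icc_subset_Icc le_rfl ht.2
  have hf : IntervalIntegrable (fun s => P.f (x s, input D x ϑ s)) volume (τ j) t :=
    (intervalIntegrable_of_pieces hji hp P.f_smooth.continuous).mono_set hsub
  have hg : IntervalIntegrable (fun s => P.g (x s, input D x ϑ s)) volume (τ j) t :=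
    (intervalIntegrable_of_pieces hji hp P.g_smooth.continuous).mono_set hsub
  have hgθ : IntervalIntegrable (fun s => P.g (x s, input D x ϑ s) θ) volume (τ j) t :=
    ((intervalIntegrable_of_pieces hji hp
      (P.g_smooth.continuous.clm_apply continuous_const)).mono_set hsub)
  rw [ContinuousLinearMap.intervalIntegral_apply hg, ← integral_add hf hgθ]
  refine (integral_eq_sub_of_hasDeriv_right_of_le ht.1
    ((continuousOn_of_pieces hji hp).mono (Icc_subset_Icc le_rfl ht.2)) ?_ (hf.add hgθ)).symm
  intro s hs
  obtain ⟨k, h1, h2, h3⟩ := exists_piece hji hs.1.le (hs.2.trans_le ht.2)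
  have := (hp k h1 h2).solvesOn.deriv s h3
  rw [loopField, ← (hp k h1 h2).const s h3] at this
  exact this.mono Ioi_subset_Ici_self

/-- The normal equations of the least-squares problem say that `γ - θ` is annihilated by the
regressor along the whole data window. -/
theorem dataZ_eq_gramG_iff {i j : ℕ} (hji : j < i)
    (hp : ∀ k, j ≤ k → k < i → IsPiece P D θ x ϑ τ k) (γ : Vec l) :
    dataZ P x (input D x ϑ) (τ i) (τ j) = gramG P x (input D x ϑ) (τ i) (τ j) γ ↔
      ∀ k, j ≤ k → k < i → ∀ t ∈ Icc (τ k) (τ (k + 1)),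
        P.g (x t, D.k (ϑ (τ k)) (x t)) (γ - θ) = 0 := by
  set G : ℝ → (Vec l →L[ℝ] Vec n) := fun s => P.g (x s, input D x ϑ s) with hGdef
  have hle : ∀ {k k'}, j ≤ k → k ≤ k' → k' ≤ i → τ k ≤ τ k' := fun h1 h2 h3 =>
    event_le_event h2 fun r hr hr' => (hp r (by omega) (by omega)).lt
  have hji' : τ j < τ i :=
    (hp j le_rfl hji).lt.trans_le (hle (by omega) (by omega : j + 1 ≤ i) le_rfl)
  have hG : IntervalIntegrable G volume (τ j) (τ i) :=
    intervalIntegrable_of_pieces hji.le hp P.g_smooth.continuous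
  have hGi : Integrable ((Ioc (τ j) (τ i)).indicator G) :=
    (integrable_indicator_iff measurableSet_Ioc).2 ((intervalIntegrable_iff_integrableOn_Ioc_of_le
      hji'.le).1 hG)
  -- Nothing is known about `G` outside the window. The indicator makes the primitive continuous on
  -- the whole line, as the Gram lemmas require, without changing it on the window.
  set Q : ℝ → (Vec l →L[ℝ] Vec n) := fun t => ∫ s in (τ j)..t, (Ioc (τ j) (τ i)).indicator G s
    with hQdef
  have hQ : Continuous Q := continuous_primitive (fun a b => hGi.intervalIntegrable) _
  have hGt : ∀ t ∈ Icc (τ j) (τ i), IntervalIntegrable G volume (τ j) t := fun t ht =>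
    hG.mono_set (by
      rw [uIcc_of_le ht.1, uIcc_of_le hji'.le]
      exact Icc_subset_Icc le_rfl ht.2)
  have hQt : ∀ t ∈ Icc (τ j) (τ i), Q t = ∫ s in (τ j)..t, G s := by
    intro t ht
    refine integral_congr_Ioo_of_le ht.1 fun s hs => ?_
    have hmem : s ∈ Ioc (τ j) (τ i) := ⟨hs.1, hs.2.le.trans ht.2⟩
    simp only [Set.indicator_of_mem hmem]
  have hq : ∀ t ∈ Icc (τ j) (τ i), ∀ σ ∈ Icc (τ j) (τ i),
      qSignal P x (input D x ϑ) t σ = Q t - Q σ := by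
    intro t ht σ hσ
    rw [hQt t ht, hQt σ hσ, integral_interval_sub_left (hGt t ht) (hGt σ hσ), qSignal]
  have hpq : ∀ t ∈ Icc (τ j) (τ i), ∀ σ ∈ Icc (τ j) (τ i),
      pSignal P x (input D x ϑ) t σ = (Q t - Q σ) θ := by
    intro t ht σ hσ
    have h1 := sub_eq_integral_of_pieces hji.le hp ht
    have h2 := sub_eq_integral_of_pieces hji.le hp hσ
    have hF : ∀ r ∈ Icc (τ j) (τ i),
        IntervalIntegrable (fun s => P.f (x s, input D x ϑ s)) volume (τ j) r := fun r hr =>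
      (intervalIntegrable_of_pieces hji.le hp P.f_smooth.continuous).mono_set (by
        rw [uIcc_of_le hr.1, uIcc_of_le hji'.le]
        exact Icc_subset_Icc le_rfl hr.2)
    rw [pSignal, ← integral_interval_sub_left (hF t ht) (hF σ hσ), hQt t ht, hQt σ hσ,
      sub_apply]
    rw [sub_eq_iff_eq_add] at h1 h2
    rw [h1, h2]
    abel
  have hgram : gramG P x (input D x ϑ) (τ i) (τ j) = ∫ t in (τ j)..(τ i), ∫ σ in (τ j)..(τ i),
      (ContinuousLinearMap.adjoint (Q t - Q σ)).comp (Q t - Q σ) := by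
    refine integral_congr fun t ht => integral_congr fun σ hσ => ?_
    rw [uIcc_of_le hji'.le] at ht hσ
    simp only [hq t ht σ hσ]
  have hdata : dataZ P x (input D x ϑ) (τ i) (τ j) =
      gramG P x (input D x ϑ) (τ i) (τ j) θ := by
    rw [hgram, gram_apply hQ]
    refine integral_congr fun t ht => integral_congr fun σ hσ => ?_
    rw [uIcc_of_le hji'.le] at ht hσ
    simp only [hq t ht σ hσ, hpq t ht σ hσ]
  rw [hdata, eq_comm, ← sub_eq_zero, ← map_sub, hgram, gram_apply_eq_zero_iff hQ hji']
  constructor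
  · intro h k hjk hki
    have hpk := hp k hjk hki
    refine eq_zero_of_forall_integral_eq_zero hpk.lt ?_ fun t ht => ?_
    · exact (P.g_smooth.continuous.comp_continuousOn (hpk.cont.prodMk
        ((continuous_k D _).comp_continuousOn hpk.cont))).clm_apply continuousOn_const
    · have hk : τ k ∈ Icc (τ j) (τ i) := ⟨hle le_rfl hjk hki.le, hle hjk hki.le le_rfl⟩
      have ht' : t ∈ Icc (τ j) (τ i) :=
        ⟨hk.1.trans ht.1, ht.2.trans (hle (by omega) (by omega : k + 1 ≤ i) le_rfl)⟩
      have h1 := h t ht' (τ k) hk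
      rw [hQt t ht', hQt _ hk, integral_interval_sub_left (hGt t ht') (hGt _ hk),
        ContinuousLinearMap.intervalIntegral_apply ((hGt _ hk).symm.trans (hGt t ht'))] at h1
      rw [← h1]
      refine integral_congr_Ioo_of_le ht.1 fun s hs => ?_
      simp only [hGdef, input, hpk.const s ⟨hs.1.le, hs.2.trans_le ht.2⟩]
  · intro h t ht σ hσ
    have hzero : ∀ r ∈ Icc (τ j) (τ i), Q r (γ - θ) = 0 := by
      intro r hr
      rw [hQt r hr, ContinuousLinearMap.intervalIntegral_apply (hGt r hr)]
      rw [integral_congr_Ioo_of_le (g := fun _ => (0 : Vec n)) hr.1,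
        intervalIntegral.integral_zero]
      intro s hs
      obtain ⟨k, h1, h2, h3⟩ := exists_piece hji.le hs.1.le (hs.2.trans_le hr.2)
      simp only [hGdef, input, (hp k h1 h2).const s h3]
      exact h k h1 h2 s (Ico_subset_Icc_self h3)
    rw [sub_apply, hzero t ht, hzero σ hσ, sub_zero]

end

/-! ### Nearest points of affine subspaces -/

/-- Pythagoras: the squared distance to `η` is the squared distance to the projected point plus a
constant. -/
theorem isMinOn_affine_iff (W : Submodule ℝ (Vec l)) (θ η γ : Vec l) (hγ : γ - θ ∈ W) :
    IsMinOn (fun γ : Vec l => ‖γ - η‖ ^ 2) {γ | γ - θ ∈ W} γ ↔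
      γ = θ + W.starProjection (η - θ) := by
  have hpyth : ∀ v : Vec l, v - θ ∈ W → ‖v - η‖ ^ 2 =
      ‖v - (θ + W.starProjection (η - θ))‖ ^ 2 + ‖(θ + W.starProjection (η - θ)) - η‖ ^ 2 := by
    intro v hv
    have h1 : v - (θ + W.starProjection (η - θ)) ∈ W := by
      have := W.sub_mem hv (W.starProjection_apply_mem (η - θ))
      rwa [sub_sub] at this
    have h2 := W.starProjection_inner_eq_zero (η - θ) _ h1
    have h3 : v - η = (v - (θ + W.starProjection (η - θ))) -
        ((η - θ) - W.starProjection (η - θ)) := by abel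
    have h4 : (θ + W.starProjection (η - θ)) - η =
        -((η - θ) - W.starProjection (η - θ)) := by abel
    rw [h4, norm_neg, h3, @norm_sub_sq_real]
    rw [real_inner_comm] at h2
    rw [h2]
    ring
  have hmem : (θ + W.starProjection (η - θ)) - θ ∈ W := by
    rw [add_sub_cancel_left]; exact W.starProjection_apply_mem _
  constructor
  · intro h
    have h1 : ‖γ - η‖ ^ 2 ≤ ‖(θ + W.starProjection (η - θ)) - η‖ ^ 2 := h hmem
    rw [hpyth γ hγ] at h1
    have h2 : ‖γ - (θ + W.starProjection (η - θ))‖ ^ 2 = 0 :=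
      le_antisymm (by linarith) (sq_nonneg _)
    exact sub_eq_zero.1 (norm_eq_zero.1 (pow_eq_zero_iff two_ne_zero |>.1 h2))
  · rintro rfl v hv
    have := hpyth v hv
    simp only [mem_ofPred_eq] at this ⊢
    nlinarith [sq_nonneg ‖v - (θ + W.starProjection (η - θ))‖]

end RegAdaptive

/-! ## Steps of the closed loop -/

namespace RegAdaptive

variable {n m l : ℕ}

/-- The least-squares update of the estimate at the event `i + 1`. -/
def IsUpdate (P : Plant n m l) (D : NominalDesign n m l) (T : ℝ) (Nt : ℕ) (x : ℝ → Vec n)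
    (ϑ : ℝ → Vec l) (τ : ℕ → ℝ) (i : ℕ) : Prop :=
  ∃ μ : ℝ, IsLeast {r : ℝ | ∃ j, j ≤ i ∧ r = τ j ∧ τ (i + 1) - Nt * T ≤ τ j} μ ∧
    ϑ (τ (i + 1)) ∈ {γ : Vec l | dataZ P x (input D x ϑ) (τ (i + 1)) μ =
        gramG P x (input D x ϑ) (τ (i + 1)) μ γ} ∧
    IsMinOn (fun γ : Vec l => ‖γ - ϑ (τ i)‖ ^ 2)
      {γ : Vec l | dataZ P x (input D x ϑ) (τ (i + 1)) μ =
        gramG P x (input D x ϑ) (τ (i + 1)) μ γ} (ϑ (τ (i + 1)))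

/-- The rules of the closed loop between the events `i` and `i + 1`, in terms of the trajectory up
to the event `i + 1` only. -/
structure IsStep (P : Plant n m l) (D : NominalDesign n m l) (T : ℝ) (a : Vec n → ℝ) (Nt : ℕ)
    (θ : Vec l) (x : ℝ → Vec n) (ϑ : ℝ → Vec l) (τ : ℕ → ℝ) (i : ℕ) : Prop where
  piece : IsPiece P D θ x ϑ τ i
  le_add : τ (i + 1) ≤ τ i + T
  eq_add_of_zero : x (τ i) = 0 → τ (i + 1) = τ i + T
  not_hit : x (τ i) ≠ 0 → ∀ t ∈ Ioo (τ i) (τ (i + 1)),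
    D.V (ϑ (τ i)) (x t) ≠ D.Q (ϑ (τ i)) (x (τ i)) + a (x (τ i))
  hit : x (τ i) ≠ 0 → τ (i + 1) = τ i + T ∨
    D.V (ϑ (τ i)) (x (τ (i + 1))) = D.Q (ϑ (τ i)) (x (τ i)) + a (x (τ i))
  update : IsUpdate P D T Nt x ϑ τ i

/-- The vectors annihilated by the regressor along the data window of the event `i + 1`. -/
def windowKernel (P : Plant n m l) (D : NominalDesign n m l) (T : ℝ) (Nt : ℕ) (x : ℝ → Vec n)
    (e : ℕ → Vec l) (τ : ℕ → ℝ) (i : ℕ) : Submodule ℝ (Vec l) where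
  carrier := {v | ∀ j ≤ i, τ (i + 1) - Nt * T ≤ τ j → ∀ t ∈ Icc (τ j) (τ (j + 1)),
    P.g (x t, D.k (e j) (x t)) v = 0}
  add_mem' := fun hv hw j hj hjT t ht => by rw [map_add, hv j hj hjT t ht, hw j hj hjT t ht, add_zero]
  zero_mem' := fun j _ _ t _ => map_zero _
  smul_mem' := fun c v hv j hj hjT t ht => by rw [map_smul, hv j hj hjT t ht, smul_zero]

variable {P : Plant n m l} {D : NominalDesign n m l} {T : ℝ} {a : Vec n → ℝ} {Nt : ℕ}
  {θ : Vec l} {x : ℝ → Vec n} {ϑ : ℝ → Vec l} {τ : ℕ → ℝ}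

/-- The feasible set of the least-squares problem is `θ + W`, so the minimizer exists, is unique,
and its error is the projection of the old error. This explicit formula replaces the integrals in
all later arguments. -/
theorem isUpdate_iff {i : ℕ} (hp : ∀ k ≤ i, IsPiece P D θ x ϑ τ k)
    (hT : 0 < T) (hNt : 0 < Nt) (hle : τ (i + 1) ≤ τ i + T) :
    IsUpdate P D T Nt x ϑ τ i ↔ ϑ (τ (i + 1)) =
      θ + (windowKernel P D T Nt x (fun j => ϑ (τ j)) τ i).starProjection (ϑ (τ i) - θ) := by
  set W := windowKernel P D T Nt x (fun j => ϑ (τ j)) τ i with hW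
  have hwin : ∀ μ, IsLeast {r : ℝ | ∃ j, j ≤ i ∧ r = τ j ∧ τ (i + 1) - Nt * T ≤ τ j} μ →
      {γ : Vec l | dataZ P x (input D x ϑ) (τ (i + 1)) μ =
        gramG P x (input D x ϑ) (τ (i + 1)) μ γ} = {γ | γ - θ ∈ W} := by
    rintro μ ⟨⟨j₀, hj₀, rfl, hj₀T⟩, hmin⟩
    ext γ
    refine (dataZ_eq_gramG_iff (by omega) (fun k _ hk => hp k (by omega)) γ).trans ?_
    constructor
    · intro h j hj hjT t ht
      refine h j ?_ (by omega) t ht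
      by_contra! hlt
      have h1 : τ j₀ ≤ τ j := hmin ⟨j, hj, rfl, hjT⟩
      have h2 : τ (j + 1) ≤ τ j₀ :=
        event_le_event (by omega) fun k _ hk => (hp k (by omega)).lt
      exact absurd (h1.trans_lt (hp j hj).lt) (not_lt.2 h2)
    · intro h k hk hki t ht
      exact h k (by omega) (hj₀T.trans (event_le_event hk fun r _ hr => (hp r (by omega)).lt)) t ht
  have hmem : θ + W.starProjection (ϑ (τ i) - θ) - θ ∈ W := by
    rw [add_sub_cancel_left]; exact W.starProjection_apply_mem _
  constructor
  · rintro ⟨μ, hμ, h1, h2⟩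
    rw [hwin μ hμ] at h1 h2
    exact (isMinOn_affine_iff W θ _ _ h1).1 h2
  · intro h
    obtain ⟨μ, hμ⟩ : ∃ μ, IsLeast
        {r : ℝ | ∃ j, j ≤ i ∧ r = τ j ∧ τ (i + 1) - Nt * T ≤ τ j} μ := by
      have hfin : {r : ℝ | ∃ j, j ≤ i ∧ r = τ j ∧ τ (i + 1) - Nt * T ≤ τ j}.Finite := by
        refine ((finite_Iic i).image τ).subset ?_
        rintro r ⟨j, hj, rfl, -⟩
        exact ⟨j, hj, rfl⟩
      -- The event `i` always lies in the window, since the last interval has length at most `T ≤ Nt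
      -- * T`.
      refine hfin.isCompact.exists_isLeast ⟨τ i, i, le_rfl, rfl, ?_⟩
      have h1 : (1 : ℝ) ≤ Nt := by exact_mod_cast hNt
      nlinarith
    refine ⟨μ, hμ, ?_⟩
    rw [hwin μ hμ, h]
    exact ⟨hmem, (isMinOn_affine_iff W θ _ _ hmem).2 rfl⟩

/-- Causality of the update: only data up to the event `i + 1` and earlier estimates enter. Gluing
and uniqueness both rest on this. -/
theorem windowKernel_congr {x' : ℝ → Vec n} {e e' : ℕ → Vec l} {τ' : ℕ → ℝ} {i : ℕ}
    (hτ : ∀ j ≤ i + 1, τ' j = τ j) (he : ∀ j ≤ i, e' j = e j)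
    (hx : ∀ j ≤ i, ∀ t ∈ Icc (τ j) (τ (j + 1)), x' t = x t) :
    windowKernel P D T Nt x' e' τ' i = windowKernel P D T Nt x e τ i := by
  ext v
  refine forall_congr' fun j => forall_congr' fun hj => ?_
  rw [hτ (i + 1) le_rfl, hτ j (by omega), hτ (j + 1) (by omega)]
  refine forall_congr' fun _ => forall_congr' fun t => forall_congr' fun ht => ?_
  rw [he j hj, hx j hj t ht]

/-! ### The estimation error along the events -/

section

variable {K : ℕ}

theorem event_nonneg (h0 : τ 0 = 0) (hs : ∀ j < K, IsStep P D T a Nt θ x ϑ τ j) {j : ℕ}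
    (hj : j ≤ K) : 0 ≤ τ j := by
  rw [← h0]
  exact event_le_event (Nat.zero_le j) fun k _ hk => (hs k (by omega)).piece.lt

theorem event_le_mul (h0 : τ 0 = 0) (hs : ∀ j < K, IsStep P D T a Nt θ x ϑ τ j) {j : ℕ}
    (hj : j ≤ K) : τ j ≤ j * T := by
  induction j with
  | zero => simp [h0]
  | succ j ih =>
    have := (hs j (by omega)).le_add
    have := ih (by omega)
    push_cast
    linarith

theorem estimate_succ (hT : 0 < T) (hNt : 0 < Nt)
    (hs : ∀ j < K, IsStep P D T a Nt θ x ϑ τ j) {i : ℕ} (hi : i < K) : ϑ (τ (i + 1)) =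
      θ + (windowKernel P D T Nt x (fun j => ϑ (τ j)) τ i).starProjection (ϑ (τ i) - θ) :=
  (isUpdate_iff (fun k hk => (hs k (by omega)).piece) hT hNt (hs i hi).le_add).1 (hs i hi).update

theorem estimate_error_succ_le (hT : 0 < T) (hNt : 0 < Nt)
    (hs : ∀ j < K, IsStep P D T a Nt θ x ϑ τ j) {i : ℕ} (hi : i < K) :
    ‖ϑ (τ (i + 1)) - θ‖ ≤ ‖ϑ (τ i) - θ‖ := by
  rw [estimate_succ hT hNt hs hi, add_sub_cancel_left]
  exact Submodule.norm_starProjection_apply_le _ _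

theorem estimate_error_le (hT : 0 < T) (hNt : 0 < Nt)
    (hs : ∀ j < K, IsStep P D T a Nt θ x ϑ τ j) {i j : ℕ} (hij : i ≤ j) (hj : j ≤ K) :
    ‖ϑ (τ j) - θ‖ ≤ ‖ϑ (τ i) - θ‖ := by
  induction j, hij using Nat.le_induction with
  | base => exact le_rfl
  | succ j hij ih =>
    exact (estimate_error_succ_le hT hNt hs (by omega)).trans (ih (by omega))

theorem estimate_eq_of_eq (hT : 0 < T) (hNt : 0 < Nt)
    (hs : ∀ j < K, IsStep P D T a Nt θ x ϑ τ j) {i j : ℕ} (hij : i ≤ j) (hj : j ≤ K)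
    (h : ϑ (τ i) = θ) : ϑ (τ j) = θ := by
  have := estimate_error_le hT hNt hs hij hj
  rw [h, sub_self, norm_zero] at this
  exact sub_eq_zero.1 (norm_le_zero_iff.1 this)

/-- Parameter observability forces the estimate to be exact after `N` events. -/
theorem estimate_eq_of_observability {N : ℕ} (hT : 0 < T) (hNt : N < Nt)
    (hobs : ParameterObservability P D N) (h0 : τ 0 = 0)
    (hs : ∀ j < N, IsStep P D T a Nt θ x ϑ τ j) (hx : x 0 ≠ 0) : ϑ (τ N) = θ := by
  by_contra hne
  -- The estimation errors play the role of the `d i`. None vanishes, since an exact estimate would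
  -- persist up to the event `N`.
  refine hx (hobs τ θ (fun i => ϑ (τ i) - θ) x h0 (fun i hi => (hs i hi).piece.lt)
    (fun i hi h => hne (estimate_eq_of_eq hT (by omega) hs hi le_rfl (sub_eq_zero.1 h))) ?_ ?_ ?_ 0
    ⟨le_rfl, event_nonneg h0 hs le_rfl⟩)
  · rw [← h0]
    exact continuousOn_of_pieces (Nat.zero_le N) fun k _ hk => (hs k hk).piece
  · intro i hi t ht
    simpa using (hs i hi).piece.deriv t ht
  · intro i hi j hj t ht
    have h1 : ϑ (τ (i + 1)) - θ ∈ windowKernel P D T Nt x (fun j => ϑ (τ j)) τ i := by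
      rw [estimate_succ hT (by omega) hs hi, add_sub_cancel_left]
      exact Submodule.starProjection_apply_mem _ _
    -- Up to the event `N` the window has not yet dropped any data: `τ (i + 1) ≤ (i + 1) * T ≤ Nt *
    -- T`.
    have h2 : τ (i + 1) - Nt * T ≤ τ j := by
      have h3 := event_le_mul h0 hs (show i + 1 ≤ N by omega)
      have h4 := event_nonneg h0 hs (show j ≤ N by omega)
      have h5 : ((i + 1 : ℕ) : ℝ) * T ≤ Nt * T :=
        mul_le_mul_of_nonneg_right (by exact_mod_cast (by omega : i + 1 ≤ Nt)) hT.le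
      linarith
    simpa using h1 j hj h2 t ht

end

/-! ### The trigger level -/

theorem V_le_Q (hH1 : Stabilizability P D) (η : Vec l) (ξ : Vec n) : D.V η ξ ≤ D.Q η ξ := by
  obtain ⟨z, hz, rfl⟩ := (hH1 η).1.complete ξ
  exact (hH1 η).2 z hz 0 le_rfl

theorem loopField_zero (P : Plant n m l) (D : NominalDesign n m l) (θ η : Vec l) :
    loopField P D θ η 0 = 0 := by
  simp [loopField, D.k_zero, P.f_zero, P.g_zero]

theorem IsPiece.eq_zero {i : ℕ} (h : IsPiece P D θ x ϑ τ i) (h0 : x (τ i) = 0) :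
    ∀ t ∈ Icc (τ i) (τ (i + 1)), x t = 0 := by
  have hz : SolvesOn (loopField P D θ (ϑ (τ i))) (fun _ => 0) (τ i) (τ (i + 1)) :=
    ⟨continuousOn_const, fun t _ => by
      simpa [loopField_zero] using hasDerivWithinAt_const t (Ici t) (0 : Vec n)⟩
  exact h.solvesOn.eqOn (contDiff_loopField P D θ _) hz h0

theorem continuous_V (D : NominalDesign n m l) (η : Vec l) : Continuous (D.V η) :=
  D.V_continuous.comp (Continuous.prodMk_right η)

/-- Away from the origin `V` starts strictly below the trigger level because `V ≤ Q` and `a > 0`, so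
it would have to cross the level before exceeding it. -/
theorem IsStep.V_le (hH1 : Stabilizability P D) (ha : IsPosDef a) {i : ℕ}
    (h : IsStep P D T a Nt θ x ϑ τ i) {t : ℝ} (ht : t ∈ Icc (τ i) (τ (i + 1))) :
    D.V (ϑ (τ i)) (x t) ≤ D.Q (ϑ (τ i)) (x (τ i)) + a (x (τ i)) := by
  by_cases h0 : x (τ i) = 0
  · rw [h.piece.eq_zero h0 t ht, h0, (D.V_posDef _).1, (D.Q_posDef _).1, ha.1, add_zero]
  · by_contra! hlt
    have h1 : D.V (ϑ (τ i)) (x (τ i)) < D.Q (ϑ (τ i)) (x (τ i)) + a (x (τ i)) := by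
      linarith [V_le_Q hH1 (ϑ (τ i)) (x (τ i)), ha.2 _ h0]
    have hc : ContinuousOn (fun s => D.V (ϑ (τ i)) (x s)) (Icc (τ i) t) :=
      (continuous_V D _).comp_continuousOn (h.piece.cont.mono (Icc_subset_Icc le_rfl ht.2))
    obtain ⟨s, hs, hse⟩ := intermediate_value_Ioo ht.1 hc ⟨h1, hlt⟩
    exact h.not_hit h0 s ⟨hs.1, hs.2.trans_le ht.2⟩ hse

theorem V_le_Q_of_solvesOn (hH1 : Stabilizability P D) {b c : ℝ}
    (h : SolvesOn (loopField P D θ θ) x b c) {t : ℝ} (ht : t ∈ Icc b c) :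
    D.V θ (x t) ≤ D.Q θ (x b) := by
  obtain ⟨z, hz, hz0⟩ := (hH1 θ).1.complete (x b)
  have h1 := h.shift b
  rw [sub_self] at h1
  have h2 := h1.eqOn (contDiff_loopField P D θ θ) (hz.solvesOn (c - b)) (by simp [hz0])
    (show t - b ∈ Icc 0 (c - b) from ⟨sub_nonneg.2 ht.1, by linarith [ht.2]⟩)
  beta_reduce at h2
  rw [add_sub_cancel] at h2
  rw [h2, ← hz0]
  exact (hH1 θ).2 z hz _ (sub_nonneg.2 ht.1)

/-- With the exact estimate no event is triggered by the growth of `V`. -/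
theorem IsStep.eq_add_of_estimate_eq (hH1 : Stabilizability P D) (ha : IsPosDef a) {i : ℕ}
    (h : IsStep P D T a Nt θ x ϑ τ i) (hϑ : ϑ (τ i) = θ) : τ (i + 1) = τ i + T := by
  by_cases h0 : x (τ i) = 0
  · exact h.eq_add_of_zero h0
  · refine (h.hit h0).resolve_right fun hV => ?_
    have h1 := h.piece.solvesOn
    rw [hϑ] at h1 hV
    have h2 := V_le_Q_of_solvesOn hH1 h1 (right_mem_Icc.2 h.piece.lt.le)
    linarith [ha.2 _ h0]

end RegAdaptive

namespace RegAdaptive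

variable {n m l : ℕ} {P : Plant n m l} {D : NominalDesign n m l} {T : ℝ} {a : Vec n → ℝ} {Nt : ℕ}
  {θ : Vec l} {x : ℝ → Vec n} {ϑ : ℝ → Vec l} {τ : ℕ → ℝ}

/-! ### Existence of a solution -/

theorem IsPiece.congr {i : ℕ} (h : IsPiece P D θ x ϑ τ i) {x' : ℝ → Vec n} {ϑ' : ℝ → Vec l}
    {τ' : ℕ → ℝ} (hτ : τ' i = τ i) (hτ1 : τ' (i + 1) = τ (i + 1))
    (hx : ∀ t ∈ Icc (τ i) (τ (i + 1)), x' t = x t)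
    (hϑ : ∀ t ∈ Ico (τ i) (τ (i + 1)), ϑ' t = ϑ t) : IsPiece P D θ x' ϑ' τ' i := by
  have h0 : ϑ' (τ i) = ϑ (τ i) := hϑ _ ⟨le_rfl, h.lt⟩
  refine ⟨?_, ?_, ?_, ?_⟩ <;> rw [hτ, hτ1]
  · exact h.lt
  · exact h.cont.congr hx
  · intro t ht
    rw [h0, hx t (Ico_subset_Icc_self ht)]
    exact (h.deriv t ht).congr (fun s hs => hx s (Ico_subset_Icc_self hs))
      (hx t (Ico_subset_Icc_self ht))
  · intro t ht
    rw [h0, hϑ t ht, h.const t ht]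

/-- All steps are transported together because an update looks back over earlier pieces. -/
theorem IsStep.congr {K : ℕ} (hT : 0 < T) (hNt : 0 < Nt) (h0 : τ 0 = 0)
    (hs : ∀ j < K, IsStep P D T a Nt θ x ϑ τ j) {x' : ℝ → Vec n} {ϑ' : ℝ → Vec l} {τ' : ℕ → ℝ}
    (hτ : ∀ j ≤ K, τ' j = τ j) (hx : ∀ t ∈ Icc 0 (τ K), x' t = x t)
    (hϑ : ∀ t ∈ Icc 0 (τ K), ϑ' t = ϑ t) : ∀ j < K, IsStep P D T a Nt θ x' ϑ' τ' j := by
  have hmem : ∀ j ≤ K, τ j ∈ Icc 0 (τ K) := fun j hj =>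
    ⟨event_nonneg h0 hs hj, event_le_event hj fun k _ hk => (hs k hk).piece.lt⟩
  have hIcc : ∀ j < K, Icc (τ j) (τ (j + 1)) ⊆ Icc 0 (τ K) := fun j hj =>
    Icc_subset_Icc (hmem j hj.le).1 (hmem (j + 1) hj).2
  have hpiece : ∀ j < K, IsPiece P D θ x' ϑ' τ' j := fun j hj =>
    (hs j hj).piece.congr (hτ j hj.le) (hτ _ hj) (fun t ht => hx t (hIcc j hj ht))
      fun t ht => hϑ t (hIcc j hj (Ico_subset_Icc_self ht))
  intro j hj
  have hxj : x' (τ j) = x (τ j) := hx _ (hmem j hj.le)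
  have hϑj : ϑ' (τ j) = ϑ (τ j) := hϑ _ (hmem j hj.le)
  have hxj1 : x' (τ (j + 1)) = x (τ (j + 1)) := hx _ (hmem _ hj)
  have hle : τ' (j + 1) ≤ τ' j + T := by rw [hτ j hj.le, hτ _ hj]; exact (hs j hj).le_add
  refine ⟨hpiece j hj, hle, ?_, ?_, ?_, (isUpdate_iff (fun k hk => hpiece k (by omega)) hT hNt
    hle).2 ?_⟩
  · rw [hτ j hj.le, hτ _ hj, hxj]; exact (hs j hj).eq_add_of_zero
  · rw [hτ j hj.le, hτ _ hj, hxj, hϑj]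
    intro h t ht
    rw [hx t (hIcc j hj (Ioo_subset_Icc_self ht))]
    exact (hs j hj).not_hit h t ht
  · rw [hτ j hj.le, hτ _ hj, hxj, hϑj, hxj1]; exact (hs j hj).hit
  · rw [windowKernel_congr (x := x) (τ := τ) (e := fun j => ϑ (τ j)) (fun k hk => hτ k (by omega))
      (fun k hk => ?_) (fun k hk t ht => hx t (hIcc k (by omega) ht)), hτ j hj.le, hτ _ hj, hϑj,
      hϑ _ (hmem _ hj)]
    · exact estimate_succ hT hNt hs hj
    · simp only [hτ k (by omega), hϑ _ (hmem k (by omega))]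

/-- The state equation can be solved until the next event. -/
theorem exists_flow_until_event (hH1 : Stabilizability P D) (ha : IsPosDef a) (hT : 0 < T)
    (θ η : Vec l) (ξ : Vec n) (b : ℝ) :
    ∃ (z : ℝ → Vec n) (r : ℝ), b < r ∧ r ≤ b + T ∧ z b = ξ ∧ ContinuousOn z (Icc b r) ∧
      (∀ t ∈ Ico b r, HasDerivWithinAt z (loopField P D θ η (z t)) (Ico b r) t) ∧
      (ξ = 0 → r = b + T) ∧ (ξ ≠ 0 → ∀ t ∈ Ioo b r, D.V η (z t) ≠ D.Q η ξ + a ξ) ∧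
      (ξ ≠ 0 → r = b + T ∨ D.V η (z r) = D.Q η ξ + a ξ) := by
  by_cases h0 : ξ = 0
  · subst h0
    refine ⟨fun _ => 0, b + T, by linarith, le_rfl, rfl, continuousOn_const, fun t _ => ?_,
      fun _ => rfl, fun h => absurd rfl h, fun h => absurd rfl h⟩
    rw [loopField_zero]
    exact hasDerivWithinAt_const _ _ _
  · have h1 : D.V η ξ < D.Q η ξ + a ξ := by linarith [V_le_Q hH1 η ξ, ha.2 _ h0]
    have h2 : 0 < D.Q η ξ + a ξ := add_pos ((D.Q_posDef η).2 ξ h0) (ha.2 ξ h0)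
    obtain ⟨z, r, hbr, hr, hz, hc, hd, hne, hhit⟩ := exists_solution_until_exit
      (contDiff_loopField P D θ η) (continuous_V D η) (D.V_radial η _ h2) h1
      (lt_add_of_pos_right b hT)
    exact ⟨z, r, hbr, hr, hz, hc, hd, fun h => absurd h h0,
      fun _ t ht => hne t (Ioo_subset_Ico_self ht), fun _ => hhit⟩

/-- A trajectory which obeys the rules up to the event `K` can be continued to the next event. -/
theorem exists_extension (hH1 : Stabilizability P D) (ha : IsPosDef a) (hT : 0 < T) (hNt : 0 < Nt)
    {K : ℕ} (h0 : τ 0 = 0) (hs : ∀ j < K, IsStep P D T a Nt θ x ϑ τ j) :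
    ∃ (x' : ℝ → Vec n) (ϑ' : ℝ → Vec l) (τ' : ℕ → ℝ),
      (∀ t ≤ τ K, x' t = x t ∧ ϑ' t = ϑ t) ∧ (∀ j ≤ K, τ' j = τ j) ∧
      ∀ j < K + 1, IsStep P D T a Nt θ x' ϑ' τ' j := by
  obtain ⟨z, r, hr, hrT, hz, hc, hd, hzero, hne, hhit⟩ :=
    exists_flow_until_event (P := P) hH1 ha hT θ (ϑ (τ K)) (x (τ K)) (τ K)
  set x' : ℝ → Vec n := fun t => if t ≤ τ K then x t else z t with hx'
  set τ' : ℕ → ℝ := Function.update τ (K + 1) r with hτ'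
  -- The new estimate uses the old estimates only, which avoids a circular definition of `ϑ'`.
  set γ : Vec l := θ + (windowKernel P D T Nt x' (fun j => ϑ (τ j)) τ' K).starProjection
    (ϑ (τ K) - θ) with hγ
  set ϑ' : ℝ → Vec l := fun t => if t ≤ τ K then ϑ t else if t < r then ϑ (τ K) else γ with hϑ'
  have eτ : ∀ j ≤ K, τ' j = τ j := fun j hj => Function.update_of_ne (by omega) _ _
  have eτK : τ' (K + 1) = r := Function.update_self _ _ _
  have ex : ∀ t ≤ τ K, x' t = x t := fun t ht => if_pos ht
  have eϑ : ∀ t ≤ τ K, ϑ' t = ϑ t := fun t ht => if_pos ht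
  have exz : ∀ t, τ K ≤ t → x' t = z t := by
    intro t ht
    rcases eq_or_lt_of_le ht with rfl | h
    · rw [ex _ le_rfl, hz]
    · exact if_neg (not_le.2 h)
  have eϑc : ∀ t ∈ Ico (τ K) r, ϑ' t = ϑ (τ K) := by
    intro t ht
    rcases eq_or_lt_of_le ht.1 with rfl | h
    · exact eϑ _ le_rfl
    · simp only [hϑ', if_neg (not_le.2 h), if_pos ht.2]
  have eϑr : ϑ' r = γ := by simp only [hϑ', if_neg (not_le.2 hr), if_neg (lt_irrefl r)]
  have hold : ∀ j < K, IsStep P D T a Nt θ x' ϑ' τ' j :=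
    IsStep.congr hT hNt h0 hs eτ (fun t ht => ex t ht.2) fun t ht => eϑ t ht.2
  have hpiece : IsPiece P D θ x' ϑ' τ' K := by
    refine ⟨?_, ?_, ?_, ?_⟩ <;> rw [eτK, eτ K le_rfl]
    · exact hr
    · exact hc.congr fun t ht => exz t ht.1
    · intro t ht
      rw [eϑ _ le_rfl, exz t ht.1]
      exact (hd t ht).congr (fun s hs => exz s hs.1) (exz t ht.1)
    · intro t ht
      rw [eϑc t ht, eϑ _ le_rfl]
  refine ⟨x', ϑ', τ', fun t ht => ⟨ex t ht, eϑ t ht⟩, eτ, fun j hj => ?_⟩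
  rcases Nat.lt_succ_iff_lt_or_eq.1 hj with hj | rfl
  · exact hold j hj
  have hle : τ' (j + 1) ≤ τ' j + T := by rw [eτK, eτ j le_rfl]; exact hrT
  refine ⟨hpiece, hle, ?_, ?_, ?_, (isUpdate_iff (θ := θ) (fun k hk => ?_) hT hNt hle).2 ?_⟩
  · rw [eτK, eτ j le_rfl, ex _ le_rfl]; exact hzero
  · rw [eτK, eτ j le_rfl, ex _ le_rfl, eϑ _ le_rfl]
    intro h t ht
    rw [exz t ht.1.le]
    exact hne h t ht
  · rw [eτK, eτ j le_rfl, ex _ le_rfl, eϑ _ le_rfl, exz r hr.le]; exact hhit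
  · rcases Nat.lt_or_eq_of_le hk with hk | rfl
    · exact (hold k hk).piece
    · exact hpiece
  · rw [eτK, eτ j le_rfl, eϑr, eϑ _ le_rfl, hγ]
    congr 3
    refine windowKernel_congr (fun _ _ => rfl) (fun k hk => ?_) fun _ _ _ _ => rfl
    have hkj : τ k ≤ τ j := event_le_event hk fun i _ hi => (hs i hi).piece.lt
    simp only [eτ k hk, eϑ _ hkj]

/-- There is a trajectory obeying the rules at all events. -/
theorem exists_steps (hH1 : Stabilizability P D) (ha : IsPosDef a) (hT : 0 < T) (hNt : 0 < Nt)
    (θ : Vec l) (x₀ : Vec n) (ϑ₀ : Vec l) :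
    ∃ (x : ℝ → Vec n) (ϑ : ℝ → Vec l) (τ : ℕ → ℝ), x 0 = x₀ ∧ ϑ 0 = ϑ₀ ∧ τ 0 = 0 ∧
      ∀ j, IsStep P D T a Nt θ x ϑ τ j := by
  let X := (ℝ → Vec n) × (ℝ → Vec l) × (ℕ → ℝ)
  let Good : ℕ → X → Prop := fun K p => p.2.2 0 = 0 ∧
    ∀ j < K, IsStep P D T a Nt θ p.1 p.2.1 p.2.2 j
  let Ext : ℕ → X → X → Prop := fun K p p' =>
    (∀ t ≤ p.2.2 K, p'.1 t = p.1 t ∧ p'.2.1 t = p.2.1 t) ∧ ∀ j ≤ K, p'.2.2 j = p.2.2 j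
  -- The existential precedes the hypothesis so that choice yields a total map, which can be
  -- iterated.
  have hext : ∀ K p, ∃ p', Good K p → Good (K + 1) p' ∧ Ext K p p' := by
    intro K p
    by_cases hp : Good K p
    · obtain ⟨x', ϑ', τ', h1, h2, h3⟩ := exists_extension hH1 ha hT hNt hp.1 hp.2
      exact ⟨(x', ϑ', τ'), fun _ => ⟨⟨(h2 0 (Nat.zero_le K)).trans hp.1, h3⟩, h1, h2⟩⟩
    · exact ⟨p, fun h => absurd h hp⟩
  choose next hnext using hext
  let S : ℕ → X := fun K => Nat.rec (fun _ => x₀, fun _ => ϑ₀, fun _ => 0) next K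
  have hgood : ∀ K, Good K (S K) := by
    intro K
    induction K with
    | zero => exact ⟨rfl, fun j hj => absurd hj (Nat.not_lt_zero j)⟩
    | succ K ih => exact (hnext K _ ih).1
  have hstep : ∀ K, Ext K (S K) (S (K + 1)) := fun K => (hnext K _ (hgood K)).2
  have hτ : ∀ K K', K ≤ K' → ∀ j ≤ K, (S K').2.2 j = (S K).2.2 j := by
    intro K K' hK
    induction K', hK using Nat.le_induction with
    | base => exact fun _ _ => rfl
    | succ K' hK ih => exact fun j hj => ((hstep K').2 j (hj.trans hK)).trans (ih j hj)
  have hx : ∀ K K', K ≤ K' → ∀ t ≤ (S K).2.2 K,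
      (S K').1 t = (S K).1 t ∧ (S K').2.1 t = (S K).2.1 t := by
    intro K K' hK
    induction K', hK using Nat.le_induction with
    | base => exact fun _ _ => ⟨rfl, rfl⟩
    | succ K' hK ih =>
      intro t ht
      have h1 : (S K).2.2 K ≤ (S K').2.2 K' := by
        rw [← hτ K K' hK K le_rfl]
        exact event_le_event hK fun j _ hj => ((hgood K').2 j hj).piece.lt
      have h2 := (hstep K').1 t (ht.trans h1)
      exact ⟨h2.1.trans (ih t ht).1, h2.2.trans (ih t ht).2⟩
  classical
  -- Accumulation of events is not yet excluded. At times that no approximation reaches the default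
  -- is harmless, because steps see only times up to an event.
  let idx : ℝ → ℕ := fun t => if h : ∃ K, t ≤ (S K).2.2 K then Nat.find h else 0
  have hidx : ∀ K t, t ≤ (S K).2.2 K →
      (S (idx t)).1 t = (S K).1 t ∧ (S (idx t)).2.1 t = (S K).2.1 t := by
    intro K t ht
    have hex : ∃ K, t ≤ (S K).2.2 K := ⟨K, ht⟩
    have h1 : idx t = Nat.find hex := dif_pos hex
    have h2 := hx (idx t) K (by rw [h1]; exact Nat.find_min' hex ht) t
      (by rw [h1]; exact Nat.find_spec hex)
    exact ⟨h2.1.symm, h2.2.symm⟩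
  have h00 : (S 0).2.2 0 = 0 := rfl
  refine ⟨fun t => (S (idx t)).1 t, fun t => (S (idx t)).2.1 t, fun j => (S j).2.2 j, ?_, ?_,
    h00, fun j => ?_⟩
  · exact (hidx 0 0 h00.ge).1
  · exact (hidx 0 0 h00.ge).2
  · exact IsStep.congr hT hNt (hgood (j + 1)).1 (hgood (j + 1)).2
      (fun k hk => (hτ k (j + 1) hk k le_rfl).symm) (fun t ht => (hidx (j + 1) t ht.2).1)
      (fun t ht => (hidx (j + 1) t ht.2).2) j (Nat.lt_succ_self j)

end RegAdaptive

/-! ### From steps to hybrid solutions and back -/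

namespace RegAdaptive

variable {n m l : ℕ} {P : Plant n m l} {D : NominalDesign n m l} {T : ℝ} {a : Vec n → ℝ} {Nt : ℕ}
  {θ : Vec l} {x : ℝ → Vec n} {ϑ : ℝ → Vec l} {τ : ℕ → ℝ}

theorem eq_zero_of_steps (h0 : τ 0 = 0) (hs : ∀ j, IsStep P D T a Nt θ x ϑ τ j) (hx : x 0 = 0)
    (i : ℕ) : ∀ t ∈ Icc 0 (τ i), x t = 0 := by
  induction i with
  | zero =>
    intro t ht
    rw [h0] at ht
    rw [le_antisymm ht.2 ht.1, hx]
  | succ i ih =>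
    intro t ht
    rcases le_total t (τ i) with h | h
    · exact ih t ⟨ht.1, h⟩
    · exact (hs i).piece.eq_zero (ih _ ⟨event_nonneg h0 (fun j _ => hs j) le_rfl, le_rfl⟩) t
        ⟨h, ht.2⟩

/-- From the event `N` on, events are equally spaced. -/
theorem event_succ_eq {N : ℕ} (hH1 : Stabilizability P D) (ha : IsPosDef a) (hT : 0 < T)
    (hNt : N < Nt) (hobs : ParameterObservability P D N) (h0 : τ 0 = 0)
    (hs : ∀ j, IsStep P D T a Nt θ x ϑ τ j) {i : ℕ} (hi : N ≤ i) : τ (i + 1) = τ i + T := by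
  by_cases hx : x 0 = 0
  · exact (hs i).eq_add_of_zero (eq_zero_of_steps h0 hs hx i _
      ⟨event_nonneg h0 (fun j _ => hs j) le_rfl, le_rfl⟩)
  · exact (hs i).eq_add_of_estimate_eq hH1 ha (estimate_eq_of_eq hT (by omega) (fun j _ => hs j)
      hi le_rfl (estimate_eq_of_observability hT hNt hobs h0 (fun j _ => hs j) hx))

/-- Absence of Zeno behaviour: the spacing is exactly `T` from the event `N` on. -/
theorem exists_lt_event {N : ℕ} (hH1 : Stabilizability P D) (ha : IsPosDef a) (hT : 0 < T)
    (hNt : N < Nt) (hobs : ParameterObservability P D N) (h0 : τ 0 = 0)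
    (hs : ∀ j, IsStep P D T a Nt θ x ϑ τ j) (t : ℝ) : ∃ i, t < τ i := by
  have h1 : ∀ k : ℕ, τ (N + k) = τ N + k * T := by
    intro k
    induction k with
    | zero => simp
    | succ k ih =>
      rw [← add_assoc, event_succ_eq hH1 ha hT hNt hobs h0 hs (by omega), ih]
      push_cast
      ring
  obtain ⟨k, hk⟩ := exists_nat_gt (t / T)
  refine ⟨N + k, ?_⟩
  rw [div_lt_iff₀ hT] at hk
  rw [h1]
  linarith [event_nonneg h0 (fun j (_ : j < N) => hs j) le_rfl]

/-- A trajectory which obeys the rules at all events, without accumulation of events, is a solution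
of the closed loop. -/
theorem isHybridSolution_of_steps (h0 : τ 0 = 0) (hs : ∀ j, IsStep P D T a Nt θ x ϑ τ j)
    (hcover : ∀ t, ∃ i, t < τ i) : IsHybridSolution P D T a Nt θ (x 0) (ϑ 0) ⊤ x ϑ τ where
  x_init := rfl
  estimate_init := rfl
  event_zero := h0
  event_strictMono := strictMono_nat_of_lt_succ fun j => (hs j).piece.lt
  event_cover := fun t _ => hcover t
  event_next := by
    intro i _
    by_cases hx : x (τ i) = 0
    · rw [triggerTime, if_pos hx, min_self, (hs i).eq_add_of_zero hx]
    · rw [triggerTime, if_neg hx]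
      refine le_antisymm (le_min (by exact_mod_cast (hs i).le_add) (le_sInf ?_)) ?_
      · rintro _ ⟨t, ⟨ht, -, hV⟩, rfl⟩
        by_contra! hlt
        exact (hs i).not_hit hx t ⟨ht, by exact_mod_cast hlt⟩ hV
      · rcases (hs i).hit hx with h | h
        · exact (min_le_left _ _).trans (by rw [h])
        · exact (min_le_right _ _).trans
            (sInf_le ⟨τ (i + 1), ⟨(hs i).piece.lt, EReal.coe_lt_top _, h⟩, rfl⟩)
  x_continuous := by
    rintro t ⟨ht, -⟩
    obtain ⟨i, hi⟩ := hcover t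
    have h1 := continuousOn_of_pieces (Nat.zero_le i) (fun k _ _ => (hs k).piece)
    rw [h0] at h1
    have h2 : ContinuousWithinAt x (Ici 0) t :=
      (h1 t ⟨ht, hi.le⟩).mono_of_mem_nhdsWithin ?_
    · exact h2.mono fun r hr => hr.1
    exact mem_nhdsWithin.2 ⟨Iio (τ i), isOpen_Iio, hi, fun r hr => ⟨hr.2, hr.1.le⟩⟩
  x_ode := fun i t h1 h2 _ => ((hs i).piece.deriv t ⟨h1, h2⟩).mono fun r hr => ⟨hr.1, hr.2.1⟩
  estimate_const := fun i t h1 h2 _ => (hs i).piece.const t ⟨h1, h2⟩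
  estimate_update := fun i _ => (hs i).update

section

variable {x₀ : Vec n} {ϑ₀ : Vec l} {s : EReal}

theorem IsHybridSolution.isPiece (h : IsHybridSolution P D T a Nt θ x₀ ϑ₀ s x ϑ τ) {i : ℕ}
    (hi : (τ (i + 1) : EReal) < s) : IsPiece P D θ x ϑ τ i where
  lt := h.event_strictMono (Nat.lt_succ_self i)
  cont := h.x_continuous.mono fun t ht => by
    refine ⟨le_trans ?_ ht.1, lt_of_le_of_lt (by exact_mod_cast ht.2) hi⟩
    rw [← h.event_zero]
    exact h.event_strictMono.monotone (Nat.zero_le i)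
  deriv := fun t ht => by
    have hlt : ∀ r : ℝ, r < τ (i + 1) → (r : EReal) < s := fun r hr =>
      lt_trans (by exact_mod_cast hr) hi
    exact (h.x_ode i t ht.1 ht.2 (hlt t ht.2)).mono fun r hr => ⟨hr.1, hr.2, hlt r hr.2⟩
  const := fun t ht => h.estimate_const i t ht.1 ht.2 (lt_trans (by exact_mod_cast ht.2) hi)

theorem IsHybridSolution.le_add (h : IsHybridSolution P D T a Nt θ x₀ ϑ₀ s x ϑ τ) {i : ℕ}
    (hi : (τ i : EReal) < s) : τ (i + 1) ≤ τ i + T := by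
  have := h.event_next i hi
  exact_mod_cast this.le.trans (min_le_left _ _)

theorem IsHybridSolution.eq_add_of_zero (h : IsHybridSolution P D T a Nt θ x₀ ϑ₀ s x ϑ τ) {i : ℕ}
    (hi : (τ i : EReal) < s) (hx : x (τ i) = 0) : τ (i + 1) = τ i + T := by
  have := h.event_next i hi
  rw [triggerTime, if_pos hx, min_self] at this
  exact_mod_cast this

theorem IsHybridSolution.le_of_hit (h : IsHybridSolution P D T a Nt θ x₀ ϑ₀ s x ϑ τ) {i : ℕ}
    (hi : (τ i : EReal) < s) (hx : x (τ i) ≠ 0) {t : ℝ} (ht : τ i < t) (hts : (t : EReal) < s)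
    (hV : D.V (ϑ (τ i)) (x t) = D.Q (ϑ (τ i)) (x (τ i)) + a (x (τ i))) : τ (i + 1) ≤ t := by
  have := h.event_next i hi
  rw [triggerTime, if_neg hx] at this
  have h2 : (τ (i + 1) : EReal) ≤ (t : EReal) :=
    (this.le.trans (min_le_right _ _)).trans (sInf_le ⟨t, ⟨ht, hts, hV⟩, rfl⟩)
  exact_mod_cast h2

/-- The infimum in the trigger is attained: otherwise continuity would exclude hits near `τ (i +
1)`, while hits exist arbitrarily close to the infimum. -/
theorem IsHybridSolution.hit (h : IsHybridSolution P D T a Nt θ x₀ ϑ₀ s x ϑ τ) {i : ℕ}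
    (hi : (τ (i + 1) : EReal) < s) (hx : x (τ i) ≠ 0) : τ (i + 1) = τ i + T ∨
      D.V (ϑ (τ i)) (x (τ (i + 1))) = D.Q (ϑ (τ i)) (x (τ i)) + a (x (τ i)) := by
  have hlt : τ i < τ (i + 1) := h.event_strictMono (Nat.lt_succ_self i)
  have hi' : (τ i : EReal) < s := lt_trans (by exact_mod_cast hlt) hi
  have hnext := h.event_next i hi'
  rw [or_iff_not_imp_left]
  intro hne
  rw [triggerTime, if_neg hx] at hnext
  rcases min_choice ((τ i + T : ℝ) : EReal) (sInf ((fun t : ℝ => (t : EReal)) '' {t : ℝ | τ i < t ∧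
      (t : EReal) < s ∧ D.V (ϑ (τ i)) (x t) = D.Q (ϑ (τ i)) (x (τ i)) + a (x (τ i))})) with hm | hm
  · rw [hm] at hnext
    exact absurd (by exact_mod_cast hnext) hne
  · rw [hm] at hnext
    by_contra hV
    have h0 : 0 ≤ τ (i + 1) := by
      rw [← h.event_zero]
      exact h.event_strictMono.monotone (Nat.zero_le _)
    have hc : ContinuousWithinAt (fun t => D.V (ϑ (τ i)) (x t))
        {t : ℝ | 0 ≤ t ∧ (t : EReal) < s} (τ (i + 1)) :=
      (continuous_V D _).continuousAt.comp_continuousWithinAt (h.x_continuous _ ⟨h0, hi⟩)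
    have hev := hc.eventually_ne hV
    rw [eventually_nhdsWithin_iff, Metric.eventually_nhds_iff] at hev
    obtain ⟨ε, hε, hev⟩ := hev
    have hlt2 : sInf ((fun t : ℝ => (t : EReal)) '' {t : ℝ | τ i < t ∧ (t : EReal) < s ∧
        D.V (ϑ (τ i)) (x t) = D.Q (ϑ (τ i)) (x (τ i)) + a (x (τ i))}) <
        ((τ (i + 1) + ε : ℝ) : EReal) := by
      rw [← hnext]
      exact_mod_cast lt_add_of_pos_right _ hε
    obtain ⟨_, ⟨t, ⟨ht, hts, hVt⟩, rfl⟩, hte⟩ := sInf_lt_iff.1 hlt2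
    have h1 : τ (i + 1) ≤ t := h.le_of_hit hi' hx ht hts hVt
    have h2 : t < τ (i + 1) + ε := EReal.coe_lt_coe_iff.1 hte
    refine hev (y := t) ?_ ⟨h0.trans h1, hts⟩ hVt
    rw [Real.dist_eq, abs_of_nonneg (sub_nonneg.2 h1)]
    linarith

theorem IsHybridSolution.isStep (h : IsHybridSolution P D T a Nt θ x₀ ϑ₀ s x ϑ τ) {i : ℕ}
    (hi : (τ (i + 1) : EReal) < s) : IsStep P D T a Nt θ x ϑ τ i := by
  have hlt : τ i < τ (i + 1) := h.event_strictMono (Nat.lt_succ_self i)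
  have hi' : (τ i : EReal) < s := lt_trans (by exact_mod_cast hlt) hi
  refine ⟨h.isPiece hi, h.le_add hi', h.eq_add_of_zero hi', fun hx t ht hV => ?_, h.hit hi,
    h.estimate_update i hi⟩
  have hts : (t : EReal) < s := lt_trans (by exact_mod_cast ht.2) hi
  exact absurd (h.le_of_hit hi' hx ht.1 hts hV) (not_le.2 ht.2)

end

/-! ### Uniqueness -/

/-- An earlier event of the second run would, by uniqueness of the flow, be a premature hit of the
first. Used in both directions, this makes the event times equal. -/
theorem IsStep.event_le {y : ℝ → Vec n} {η : ℝ → Vec l} {ρ : ℕ → ℝ} {i : ℕ}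
    (h : IsStep P D T a Nt θ x ϑ τ i) (h' : IsStep P D T a Nt θ y η ρ i) (hτ : ρ i = τ i)
    (hx : y (τ i) = x (τ i)) (hϑ : η (τ i) = ϑ (τ i)) : τ (i + 1) ≤ ρ (i + 1) := by
  by_contra! hlt
  have hle := h'.piece.lt.le
  have hsy := h'.piece.solvesOn
  have hadd := h.le_add
  have hzero := h'.eq_add_of_zero
  have hhit := h'.hit
  rw [hτ] at hle hsy hzero hhit
  rw [hϑ] at hsy hhit
  rw [hx] at hzero hhit
  by_cases h0 : x (τ i) = 0
  · linarith [hzero h0]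
  · rcases hhit h0 with h1 | h1
    · linarith
    · have h2 := hsy.eqOn (contDiff_loopField P D θ _) (h.piece.solvesOn.mono le_rfl hlt.le) hx
        (right_mem_Icc.2 hle)
      rw [h2] at h1
      have hlt' := h'.piece.lt
      rw [hτ] at hlt'
      exact h.not_hit h0 _ ⟨hlt', hlt⟩ h1

theorem IsHybridSolution.unique {x₀ : Vec n} {ϑ₀ : Vec l} {s : EReal} {y : ℝ → Vec n}
    {η : ℝ → Vec l} {ρ : ℕ → ℝ} (hT : 0 < T) (hNt : 0 < Nt) (hx0 : x 0 = x₀) (hϑ0 : ϑ 0 = ϑ₀)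
    (h0 : τ 0 = 0) (hs : ∀ j, IsStep P D T a Nt θ x ϑ τ j)
    (h : IsHybridSolution P D T a Nt θ x₀ ϑ₀ s y η ρ) :
    (∀ t : ℝ, 0 ≤ t → (t : EReal) < s → y t = x t ∧ η t = ϑ t) ∧
      ∀ i, (ρ i : EReal) < s → ρ i = τ i := by
  have hρs : ∀ {j i}, j ≤ i → (ρ i : EReal) < s → (ρ j : EReal) < s := fun hji hi =>
    lt_of_le_of_lt (by exact_mod_cast h.event_strictMono.monotone hji) hi
  have key : ∀ i, (ρ i : EReal) < s →
      (∀ j ≤ i, ρ j = τ j) ∧ ∀ t ∈ Icc 0 (τ i), y t = x t ∧ η t = ϑ t := by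
    intro i
    induction i with
    | zero =>
      intro _
      refine ⟨fun j hj => ?_, fun t ht => ?_⟩
      · rw [Nat.le_zero.1 hj, h.event_zero, h0]
      · rw [h0] at ht
        rw [le_antisymm ht.2 ht.1, h.x_init, h.estimate_init, hx0, hϑ0]
        exact ⟨rfl, rfl⟩
    | succ i ih =>
      intro hi
      obtain ⟨hρ, hag⟩ := ih (hρs (Nat.le_succ i) hi)
      have hy : ∀ j < i + 1, IsStep P D T a Nt θ y η ρ j := fun j hj => h.isStep (hρs hj hi)
      have hmem : ∀ j ≤ i, τ j ∈ Icc 0 (τ i) := fun j hj =>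
        ⟨event_nonneg h0 (fun k (_ : k < j) => hs k) le_rfl,
          event_le_event hj fun k _ _ => (hs k).piece.lt⟩
      have hi0 := hmem i le_rfl
      have hρi := hρ i le_rfl
      have hρi1 : ρ (i + 1) = τ (i + 1) := le_antisymm
        ((hy i (Nat.lt_succ_self i)).event_le (hs i) hρi.symm
          (by rw [hρi]; exact (hag _ hi0).1.symm) (by rw [hρi]; exact (hag _ hi0).2.symm))
        ((hs i).event_le (hy i (Nat.lt_succ_self i)) hρi (hag _ hi0).1 (hag _ hi0).2)
      have hρ' : ∀ j ≤ i + 1, ρ j = τ j := by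
        intro j hj
        rcases Nat.lt_or_eq_of_le hj with hj | rfl
        · exact hρ j (by omega)
        · exact hρi1
      have hsol := (hy i (Nat.lt_succ_self i)).piece.solvesOn
      rw [hρi, hρi1, (hag _ hi0).2] at hsol
      have hx : ∀ t ∈ Icc 0 (τ (i + 1)), y t = x t := by
        intro t ht
        rcases le_total t (τ i) with h1 | h1
        · exact (hag t ⟨ht.1, h1⟩).1
        · exact hsol.eqOn (contDiff_loopField P D θ _) (hs i).piece.solvesOn (hag _ hi0).1
            ⟨h1, ht.2⟩
      have hϑ : ∀ t ∈ Icc 0 (τ (i + 1)), η t = ϑ t := by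
        intro t ht
        rcases le_total t (τ i) with h1 | h1
        · exact (hag t ⟨ht.1, h1⟩).2
        · rcases eq_or_lt_of_le ht.2 with rfl | h2
          · have e1 := estimate_succ hT hNt hy (Nat.lt_succ_self i)
            rw [hρi1, hρi, (hag _ hi0).2] at e1
            rw [e1, estimate_succ hT hNt (fun j (_ : j < i + 1) => hs j) (Nat.lt_succ_self i)]
            congr 3
            refine windowKernel_congr hρ' (fun j hj => ?_) fun j hj t ht => hx t ?_
            · simp only [hρ j hj, (hag _ (hmem j hj)).2]
            · exact ⟨(hmem j hj).1.trans ht.1, ht.2.trans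
                (event_le_event (by omega) fun k _ _ => (hs k).piece.lt)⟩
          · have e1 := (hy i (Nat.lt_succ_self i)).piece.const t
            rw [hρi1, hρi, (hag _ hi0).2] at e1
            rw [e1 ⟨h1, h2⟩, (hs i).piece.const t ⟨h1, h2⟩]
      exact ⟨hρ', fun t ht => ⟨hx t ht, hϑ t ht⟩⟩
  refine ⟨fun t ht hts => ?_, fun i hi => (key i hi).1 i le_rfl⟩
  obtain ⟨k, hk⟩ := h.event_cover t hts
  obtain ⟨i, -, -, hti⟩ := exists_piece (Nat.zero_le k) (by rw [h.event_zero]; exact ht) hk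
  have hi : (ρ i : EReal) < s := lt_of_le_of_lt (by exact_mod_cast hti.1) hts
  obtain ⟨hρ, hag⟩ := key i hi
  have hρi := hρ i le_rfl
  have hi0 : τ i ∈ Icc 0 (τ i) := ⟨event_nonneg h0 (fun k (_ : k < i) => hs k) le_rfl, le_rfl⟩
  have hsol : SolvesOn (loopField P D θ (ϑ (τ i))) y (τ i) t := by
    refine ⟨h.x_continuous.mono fun r hr =>
      ⟨hi0.1.trans hr.1, lt_of_le_of_lt (by exact_mod_cast hr.2) hts⟩, fun r hr => ?_⟩
    have h1 := h.x_ode i r (by rw [hρi]; exact hr.1) (hr.2.trans hti.2)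
      (lt_trans (by exact_mod_cast hr.2) hts)
    rw [hρi, (hag _ hi0).2] at h1
    exact hasDerivWithinAt_Ici_of_Ico (a := τ i) (b := t) hr (h1.mono fun q hq =>
      ⟨hq.1, hq.2.trans hti.2, lt_trans (by exact_mod_cast hq.2) hts⟩)
  -- The interval of `y` containing `t` may extend beyond `s`, so it need not form an `IsStep`. If
  -- `t` were past `τ (i + 1)`, then `y = x` up to that time, and either the limit `T` or the same
  -- hit would force `ρ (i + 1) ≤ t`.
  have hlt : t < τ (i + 1) := by
    by_contra! hge
    have h1 := h.le_add hi
    rw [hρi] at h1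
    by_cases hx : x (τ i) = 0
    · linarith [(hs i).eq_add_of_zero hx, hti.2]
    · rcases (hs i).hit hx with h2 | h2
      · linarith [hti.2]
      · have h3 : y (τ (i + 1)) = x (τ (i + 1)) :=
          (hsol.mono le_rfl hge).eqOn (contDiff_loopField P D θ _) (hs i).piece.solvesOn
            (hag _ hi0).1 (right_mem_Icc.2 (hs i).piece.lt.le)
        have h4 := h.le_of_hit hi (t := τ (i + 1)) (by rwa [hρi, (hag _ hi0).1])
          (by rw [hρi]; exact (hs i).piece.lt) (lt_of_le_of_lt (by exact_mod_cast hge) hts)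
          (by rw [hρi, (hag _ hi0).1, (hag _ hi0).2, h3]; exact h2)
        linarith [hti.2]
  have hτt : τ i ≤ t := by rw [← hρi]; exact hti.1
  refine ⟨hsol.eqOn (contDiff_loopField P D θ _) ((hs i).piece.solvesOn.mono le_rfl hlt.le)
    (hag _ hi0).1 (right_mem_Icc.2 hτt), ?_⟩
  rw [h.estimate_const i t hti.1 hti.2 hts, (hs i).piece.const t ⟨hτt, hlt⟩, hρi, (hag _ hi0).2]

end RegAdaptive

namespace RegAdaptive

variable {n m l : ℕ} {P : Plant n m l} {D : NominalDesign n m l} {T : ℝ} {a : Vec n → ℝ} {Nt : ℕ}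
  {θ : Vec l} {x : ℝ → Vec n} {ϑ : ℝ → Vec l} {τ : ℕ → ℝ}

/-! ### Bounds on solutions -/

theorem continuous_level (D : NominalDesign n m l) (ha : Continuous a) :
    Continuous fun p : Vec l × Vec n => D.Q p.1 p.2 + a p.2 :=
  D.Q_continuous.add (ha.comp continuous_snd)

/-- The trigger level is bounded on compact sets, and uniform coercivity turns a bound on `V` into a
bound on the state, uniformly in the estimate. -/
theorem exists_gain_bound (hH2 : UniformCoercivity D) (ha : Continuous a) {Θ : Set (Vec l)}
    (hΘ : IsCompact Θ) (hne : Θ.Nonempty) (s : ℝ) :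
    ∃ B : ℝ, ∀ η ∈ Θ, ∀ ξ : Vec n, ‖ξ‖ ≤ s → ∀ y : Vec n, D.V η y ≤ D.Q η ξ + a ξ → ‖y‖ ≤ B := by
  obtain ⟨M, hM⟩ := (hΘ.prod (isCompact_closedBall (0 : Vec n) s)).exists_bound_of_continuousOn
    (continuous_level D ha).continuousOn
  obtain ⟨B, -, hB⟩ := hH2 Θ hne hΘ (max M 0) (le_max_right _ _)
  refine ⟨B, fun η hη ξ hξ y hy => hB η hη y ?_⟩
  have h1 := hM (η, ξ) ⟨hη, mem_closedBall_zero_iff.2 hξ⟩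
  exact hy.trans (((le_abs_self _).trans h1).trans (le_max_left _ _))

/-- By compactness `V` has a positive lower bound `c` on the shell `ε ≤ ‖y‖ ≤ B`, uniformly in `η`,
whereas the trigger level tends to zero with `ξ`, uniformly in `η`. The bound `B` for `‖ξ‖ ≤ 1`
rules out points beyond the shell. -/
theorem exists_gain_small (hH2 : UniformCoercivity D) (ha : Continuous a) (ha0 : IsPosDef a)
    {Θ : Set (Vec l)} (hΘ : IsCompact Θ) (hne : Θ.Nonempty) {ε : ℝ} (hε : 0 < ε) :
    ∃ δ : ℝ, 0 < δ ∧ ∀ η ∈ Θ, ∀ ξ : Vec n, ‖ξ‖ ≤ δ → ∀ y : Vec n,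
      D.V η y ≤ D.Q η ξ + a ξ → ‖y‖ ≤ ε := by
  obtain ⟨B, hB⟩ := exists_gain_bound hH2 ha hΘ hne 1
  obtain ⟨c, hc, hVc⟩ : ∃ c : ℝ, 0 < c ∧ ∀ η ∈ Θ, ∀ y : Vec n, ε ≤ ‖y‖ → ‖y‖ ≤ B →
      c ≤ D.V η y := by
    have hC : IsCompact (Θ ×ˢ (Metric.closedBall (0 : Vec n) B ∩ {y | ε ≤ ‖y‖})) :=
      hΘ.prod ((isCompact_closedBall _ _).inter_right
        (isClosed_le continuous_const continuous_norm))
    rcases (Θ ×ˢ (Metric.closedBall (0 : Vec n) B ∩ {y | ε ≤ ‖y‖})).eq_empty_or_nonempty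
      with he | hn
    · refine ⟨1, one_pos, fun η hη y h1 h2 => ?_⟩
      have : (η, y) ∈ Θ ×ˢ (Metric.closedBall (0 : Vec n) B ∩ {y | ε ≤ ‖y‖}) :=
        ⟨hη, mem_closedBall_zero_iff.2 h2, h1⟩
      rw [he] at this
      exact this.elim
    · obtain ⟨p, hp, hmin⟩ := hC.exists_isMinOn hn D.V_continuous.continuousOn
      refine ⟨D.V p.1 p.2, (D.V_posDef p.1).2 _ ?_, fun η hη y h1 h2 =>
        hmin (show (η, y) ∈ _ from ⟨hη, mem_closedBall_zero_iff.2 h2, h1⟩)⟩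
      have h1 : ε ≤ ‖p.2‖ := hp.2.2
      exact norm_pos_iff.1 (hε.trans_le h1)
  have hev : ∀ᶠ ξ : Vec n in 𝓝 0, ∀ η ∈ Θ, D.Q η ξ + a ξ < c := by
    refine hΘ.eventually_forall_of_forall_eventually fun η _ => ?_
    have hcont : Continuous fun p : Vec n × Vec l => D.Q p.2 p.1 + a p.1 :=
      (continuous_level D ha).comp continuous_swap
    refine hcont.continuousAt.eventually (gt_mem_nhds ?_)
    simpa [(D.Q_posDef η).1, ha0.1] using hc
  obtain ⟨δ, hδ, hev⟩ := Metric.eventually_nhds_iff.1 hev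
  refine ⟨min (δ / 2) 1, by positivity, fun η hη ξ hξ y hy => ?_⟩
  by_contra! hlt
  have h1 : D.Q η ξ + a ξ < c := by
    refine hev ?_ η hη
    rw [dist_zero_right]
    linarith [hξ.trans (min_le_left _ _)]
  linarith [hVc η hη y hlt.le (hB η hη ξ (hξ.trans (min_le_right _ _)) y hy)]

/-- The error norm never increases, so one compact ball of estimates serves every interval and the
gain bound can be iterated. The event times may vary with the trajectory; the bound does not. -/
theorem exists_bound_until_event (hH1 : Stabilizability P D) (hH2 : UniformCoercivity D)
    (hac : Continuous a) (ha : IsPosDef a) (hT : 0 < T) (hNt : 0 < Nt) (θ ϑ₀ : Vec l) (s : ℝ)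
    (i : ℕ) : ∃ B : ℝ, ∀ (x : ℝ → Vec n) (ϑ : ℝ → Vec l) (τ : ℕ → ℝ), τ 0 = 0 → ϑ 0 = ϑ₀ →
      (∀ j, IsStep P D T a Nt θ x ϑ τ j) → ‖x 0‖ ≤ s → ∀ t ∈ Icc 0 (τ i), ‖x t‖ ≤ B := by
  induction i with
  | zero =>
    refine ⟨s, fun x ϑ τ h0 _ _ hx t ht => ?_⟩
    rw [h0] at ht
    rwa [le_antisymm ht.2 ht.1]
  | succ i ih =>
    obtain ⟨B, hB⟩ := ih
    obtain ⟨B', hB'⟩ := exists_gain_bound hH2 hac (isCompact_closedBall θ ‖ϑ₀ - θ‖)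
      ⟨θ, Metric.mem_closedBall_self (norm_nonneg _)⟩ B
    refine ⟨max B B', fun x ϑ τ h0 hϑ hs hx t ht => ?_⟩
    have h1 := hB x ϑ τ h0 hϑ hs hx
    rcases le_total t (τ i) with h | h
    · exact (h1 t ⟨ht.1, h⟩).trans (le_max_left _ _)
    · refine (hB' (ϑ (τ i)) ?_ (x (τ i)) (h1 _ ⟨event_nonneg h0 (fun j (_ : j < i) => hs j) le_rfl,
        le_rfl⟩) _ ((hs i).V_le hH1 ha ⟨h, ht.2⟩)).trans (le_max_right _ _)
      have h2 := estimate_error_le hT hNt (fun j (_ : j < i) => hs j) (Nat.zero_le i) le_rfl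
      rw [h0, hϑ] at h2
      rwa [mem_closedBall_iff_norm]

theorem exists_small_until_event (hH1 : Stabilizability P D) (hH2 : UniformCoercivity D)
    (hac : Continuous a) (ha : IsPosDef a) (hT : 0 < T) (hNt : 0 < Nt) (θ ϑ₀ : Vec l) {ε : ℝ}
    (hε : 0 < ε) (i : ℕ) : ∃ δ : ℝ, 0 < δ ∧ ∀ (x : ℝ → Vec n) (ϑ : ℝ → Vec l) (τ : ℕ → ℝ),
      τ 0 = 0 → ϑ 0 = ϑ₀ → (∀ j, IsStep P D T a Nt θ x ϑ τ j) → ‖x 0‖ ≤ δ →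
      ∀ t ∈ Icc 0 (τ i), ‖x t‖ ≤ ε := by
  induction i generalizing ε with
  | zero =>
    refine ⟨ε, hε, fun x ϑ τ h0 _ _ hx t ht => ?_⟩
    rw [h0] at ht
    rwa [le_antisymm ht.2 ht.1]
  | succ i ih =>
    obtain ⟨δ', hδ', hB'⟩ := exists_gain_small hH2 hac ha (isCompact_closedBall θ ‖ϑ₀ - θ‖)
      ⟨θ, Metric.mem_closedBall_self (norm_nonneg _)⟩ hε
    obtain ⟨δ, hδ, hB⟩ := ih (lt_min hε hδ')
    refine ⟨δ, hδ, fun x ϑ τ h0 hϑ hs hx t ht => ?_⟩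
    have h1 := hB x ϑ τ h0 hϑ hs hx
    rcases le_total t (τ i) with h | h
    · exact (h1 t ⟨ht.1, h⟩).trans (min_le_left _ _)
    · refine hB' (ϑ (τ i)) ?_ (x (τ i)) ((h1 _ ⟨event_nonneg h0 (fun j (_ : j < i) => hs j) le_rfl,
        le_rfl⟩).trans (min_le_right _ _)) _ ((hs i).V_le hH1 ha ⟨h, ht.2⟩)
      have h2 := estimate_error_le hT hNt (fun j (_ : j < i) => hs j) (Nat.zero_le i) le_rfl
      rw [h0, hϑ] at h2
      rwa [mem_closedBall_iff_norm]

/-- From the event `N` on, the trajectory is a solution of the nominal closed loop. -/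
theorem exists_forwardSolution_tail {N : ℕ} (hH1 : Stabilizability P D) (ha : IsPosDef a)
    (hT : 0 < T) (hNt : N < Nt) (hobs : ParameterObservability P D N) (h0 : τ 0 = 0)
    (hs : ∀ j, IsStep P D T a Nt θ x ϑ τ j) : ∃ z, IsForwardSolution (loopField P D θ θ) z ∧
      z 0 = x (τ N) ∧ ∀ t, τ N ≤ t → x t = z (t - τ N) := by
  obtain ⟨z, hz, hz0⟩ := (hH1 θ).1.complete (x (τ N))
  refine ⟨z, hz, hz0, fun t ht => ?_⟩
  obtain ⟨i, hi⟩ := exists_lt_event hH1 ha hT hNt hobs h0 hs t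
  have hNi : N ≤ i := by
    by_contra! hlt
    exact absurd (event_le_event hlt.le fun k _ _ => (hs k).piece.lt) (not_le.2 (ht.trans_lt hi))
  have hsol : ∀ k, N ≤ k → SolvesOn (loopField P D θ θ) x (τ N) (τ k) := by
    have hN0 : τ N ∈ Icc 0 (τ N) := ⟨event_nonneg h0 (fun j (_ : j < N) => hs j) le_rfl, le_rfl⟩
    by_cases hx : x 0 = 0
    · intro k hk
      have hzero : ∀ r ∈ Icc (τ N) (τ k), x r = 0 := fun r hr =>
        eq_zero_of_steps h0 hs hx k r ⟨hN0.1.trans hr.1, hr.2⟩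
      refine ⟨continuousOn_of_pieces hk fun j _ _ => (hs j).piece, fun r hr => ?_⟩
      rw [hzero r (Ico_subset_Icc_self hr), loopField_zero]
      refine ((hasDerivWithinAt_const r (Ico r (τ k)) (0 : Vec n)).congr (fun q hq =>
        hzero q ⟨hr.1.trans hq.1, hq.2.le⟩) (hzero r (Ico_subset_Icc_self hr))
        ).mono_of_mem_nhdsWithin (Ico_mem_nhdsGE hr.2)
    · intro k hk
      induction k, hk using Nat.le_induction with
      | base => exact ⟨by simp, fun r hr => absurd hr.1 (not_le.2 hr.2)⟩
      | succ k hk ih =>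
        have h1 := (hs k).piece.solvesOn
        rw [estimate_eq_of_eq hT (by omega) (fun j _ => hs j) hk le_rfl
          (estimate_eq_of_observability hT hNt hobs h0 (fun j _ => hs j) hx)] at h1
        exact ih.trans h1 (event_le_event hk fun j _ _ => (hs j).piece.lt) (hs k).piece.lt.le
  have h1 := (hsol i hNi).shift (τ N)
  rw [sub_self] at h1
  have h2 := h1.eqOn (contDiff_loopField P D θ θ) (hz.solvesOn (τ i - τ N)) (by simp [hz0])
    (show t - τ N ∈ Icc 0 (τ i - τ N) from ⟨sub_nonneg.2 ht, by linarith⟩)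
  beta_reduce at h2
  rwa [add_sub_cancel] at h2

theorem exists_classKL_bound_of_steps {N : ℕ} (hH1 : Stabilizability P D)
    (hH2 : UniformCoercivity D) (hac : Continuous a) (ha : IsPosDef a) (hT : 0 < T) (hNt : N < Nt)
    (hobs : ParameterObservability P D N) (θ ϑ₀ : Vec l) (X : Vec n → ℝ → Vec n)
    (E : Vec n → ℝ → Vec l) (τ : Vec n → ℕ → ℝ) (hX : ∀ ξ, X ξ 0 = ξ) (hE : ∀ ξ, E ξ 0 = ϑ₀)
    (h0 : ∀ ξ, τ ξ 0 = 0) (hs : ∀ ξ j, IsStep P D T a Nt θ (X ξ) (E ξ) (τ ξ) j) :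
    ∃ σ, IsClassKL σ ∧ ∀ ξ t, 0 ≤ t → ‖X ξ t‖ ≤ σ ‖ξ‖ t := by
  have hNt0 : 0 < Nt := by omega
  have hΘ := isCompact_closedBall θ ‖ϑ₀ - θ‖
  have hθ : θ ∈ Metric.closedBall θ ‖ϑ₀ - θ‖ := Metric.mem_closedBall_self (norm_nonneg _)
  have hN0 : ∀ ξ, 0 ≤ τ ξ N := fun ξ => event_nonneg (h0 ξ) (fun j (_ : j < N) => hs ξ j) le_rfl
  -- Weakening the nominal estimate by `a` lets the same two gain lemmas treat the tail, with `η =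
  -- θ`.
  have hV : ∀ z, IsForwardSolution (loopField P D θ θ) z → ∀ t, 0 ≤ t →
      D.V θ (z t) ≤ D.Q θ (z 0) + a (z 0) := by
    intro z hz t ht
    have h1 : 0 ≤ a (z 0) := by
      by_cases h : z 0 = 0
      · rw [h, ha.1]
      · exact (ha.2 _ h).le
    linarith [(hH1 θ).2 z hz t ht]
  have hbound : ∀ s : ℝ, ∃ B : ℝ, ∀ z, IsForwardSolution (loopField P D θ θ) z → ‖z 0‖ ≤ s →
      ∀ t, 0 ≤ t → ‖z t‖ ≤ B := by
    intro s
    obtain ⟨B, hB⟩ := exists_gain_bound hH2 hac hΘ ⟨θ, hθ⟩ s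
    exact ⟨B, fun z hz hzs t ht => hB θ hθ _ hzs _ (hV z hz t ht)⟩
  have htail : ∀ ξ, ∃ z, IsForwardSolution (loopField P D θ θ) z ∧
      z 0 = X ξ (τ ξ N) ∧ ∀ t, τ ξ N ≤ t → X ξ t = z (t - τ ξ N) := fun ξ =>
    exists_forwardSolution_tail hH1 ha hT hNt hobs (h0 ξ) (hs ξ)
  refine exists_classKL_bound (fun ξ : Vec n => ‖ξ‖) (fun ξ t => ‖X ξ t‖)
    (fun ξ => norm_nonneg ξ) ?_ ?_ ?_
  · intro s
    obtain ⟨B, hB⟩ := exists_bound_until_event hH1 hH2 hac ha hT hNt0 θ ϑ₀ s N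
    obtain ⟨B', hB'⟩ := hbound B
    refine ⟨max B B', fun ξ hξ t ht => ?_⟩
    have h1 := hB _ _ _ (h0 ξ) (hE ξ) (hs ξ) (by rwa [hX])
    rcases le_total t (τ ξ N) with h | h
    · exact (h1 t ⟨ht, h⟩).trans (le_max_left _ _)
    · obtain ⟨z, hz, hz0, hzX⟩ := htail ξ
      rw [hzX t h]
      exact (hB' z hz (by rw [hz0]; exact h1 _ ⟨hN0 ξ, le_rfl⟩) _ (sub_nonneg.2 h)).trans
        (le_max_right _ _)
  · intro ε hε
    obtain ⟨δ', hδ', hB'⟩ := exists_gain_small hH2 hac ha hΘ ⟨θ, hθ⟩ hε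
    obtain ⟨δ, hδ, hB⟩ := exists_small_until_event hH1 hH2 hac ha hT hNt0 θ ϑ₀ (lt_min hε hδ') N
    refine ⟨δ, hδ, fun ξ hξ t ht => ?_⟩
    have h1 := hB _ _ _ (h0 ξ) (hE ξ) (hs ξ) (by rwa [hX])
    rcases le_total t (τ ξ N) with h | h
    · exact (h1 t ⟨ht, h⟩).trans (min_le_left _ _)
    · obtain ⟨z, hz, hz0, hzX⟩ := htail ξ
      rw [hzX t h]
      refine hB' θ hθ (z 0) ?_ _ (hV z hz _ (sub_nonneg.2 h))
      rw [hz0]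
      exact (h1 _ ⟨hN0 ξ, le_rfl⟩).trans (min_le_right _ _)
  · intro s ε hε
    obtain ⟨B, hB⟩ := exists_bound_until_event hH1 hH2 hac ha hT hNt0 θ ϑ₀ s N
    obtain ⟨T', hT', hattr⟩ :=
      (hH1 θ).1.uniformly_attractive (contDiff_loopField P D θ θ) hbound B ε hε
    -- The nominal phase starts at `τ N ≤ N * T`, from a state bounded by `B`; it needs at most `T'`
    -- more.
    refine ⟨N * T + T', fun ξ hξ t _ hTt => ?_⟩
    have h1 := hB _ _ _ (h0 ξ) (hE ξ) (hs ξ) (by rwa [hX])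
    have h2 : τ ξ N ≤ N * T := event_le_mul (h0 ξ) (fun j (_ : j < N) => hs ξ j) le_rfl
    obtain ⟨z, hz, hz0, hzX⟩ := htail ξ
    rw [hzX t (by linarith)]
    exact hattr z hz (by rw [hz0]; exact h1 _ ⟨hN0 ξ, le_rfl⟩) _ (by linarith)

end RegAdaptive

/-! ### The main theorem -/

theorem theorem3p1 {n m l : ℕ} (P : Plant n m l) (D : NominalDesign n m l)
    (hH1 : Stabilizability P D) (hH2 : UniformCoercivity D)
    (N : ℕ) (hN : 0 < N) (hH3 : ParameterObservability P D N)
    (T : ℝ) (hT : 0 < T)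
    (a : Vec n → ℝ) (ha_cont : Continuous a) (ha_pos : IsPosDef a)
    (Nt : ℕ) (hNt : N < Nt) :
    ∃ σ : Vec l → Vec l → ℝ → ℝ → ℝ,
      (∀ θ ϑ₀, IsClassKL (σ θ ϑ₀)) ∧
      ∀ (θ : Vec l) (x₀ : Vec n) (ϑ₀ : Vec l),
        ∃ (x : ℝ → Vec n) (ϑ : ℝ → Vec l) (τ : ℕ → ℝ),
          -- a solution which is defined for all nonnegative times
          IsHybridSolution P D T a Nt θ x₀ ϑ₀ ⊤ x ϑ τ ∧
          -- uniqueness: every solution, on any interval, is a restriction of it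
          (∀ (s : EReal) (y : ℝ → Vec n) (η : ℝ → Vec l) (ρ : ℕ → ℝ),
            IsHybridSolution P D T a Nt θ x₀ ϑ₀ s y η ρ →
              (∀ t : ℝ, 0 ≤ t → (t : EReal) < s → y t = x t ∧ η t = ϑ t) ∧
              (∀ i, (ρ i : EReal) < s → ρ i = τ i)) ∧
          (∀ t : ℝ, 0 ≤ t → ‖x t‖ ≤ σ θ ϑ₀ ‖x₀‖ t) ∧
          (x₀ ≠ 0 → ∀ t : ℝ, N * T ≤ t → ϑ t = θ) := by
  have hNt0 : 0 < Nt := by omega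
  have hsol := fun (θ ϑ₀ : Vec l) (x₀ : Vec n) =>
    exists_steps (P := P) (Nt := Nt) hH1 ha_pos hT hNt0 θ x₀ ϑ₀
  choose X E τ hX hE h0 hs using hsol
  -- For fixed `θ` and `ϑ₀` the bound is extracted from the whole family of trajectories indexed by
  -- the initial state.
  choose σ hσ hbound using fun θ ϑ₀ => exists_classKL_bound_of_steps hH1 hH2 ha_cont ha_pos hT hNt
    hH3 θ ϑ₀ (X θ ϑ₀) (E θ ϑ₀) (τ θ ϑ₀) (hX θ ϑ₀) (hE θ ϑ₀) (h0 θ ϑ₀) (hs θ ϑ₀)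
  refine ⟨σ, hσ, fun θ x₀ ϑ₀ => ⟨X θ ϑ₀ x₀, E θ ϑ₀ x₀, τ θ ϑ₀ x₀, ?_, fun s y η ρ h =>
    h.unique hT hNt0 (hX _ _ _) (hE _ _ _) (h0 _ _ _) (hs _ _ _), hbound θ ϑ₀ x₀,
    fun hx₀ t ht => ?_⟩⟩
  · have := isHybridSolution_of_steps (h0 θ ϑ₀ x₀) (hs θ ϑ₀ x₀)
      (exists_lt_event hH1 ha_pos hT hNt hH3 (h0 θ ϑ₀ x₀) (hs θ ϑ₀ x₀))
    rwa [hX, hE] at this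
  · have hst := hs θ ϑ₀ x₀
    obtain ⟨i, hi⟩ := exists_lt_event hH1 ha_pos hT hNt hH3 (h0 θ ϑ₀ x₀) hst t
    have hNt' : τ θ ϑ₀ x₀ N ≤ t :=
      (event_le_mul (h0 θ ϑ₀ x₀) (fun j (_ : j < N) => hst j) le_rfl).trans ht
    have hNi : N ≤ i := by
      by_contra! hlt
      exact absurd (event_le_event hlt.le fun k _ _ => (hst k).piece.lt)
        (not_le.2 (hNt'.trans_lt hi))
    obtain ⟨k, hk, -, htk⟩ := exists_piece hNi hNt' hi
    rw [(hst k).piece.const t htk]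
    exact estimate_eq_of_eq hT hNt0 (fun j _ => hst j) hk le_rfl
      (estimate_eq_of_observability hT hNt hH3 (h0 θ ϑ₀ x₀) (fun j _ => hst j) (by rwa [hX]))
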